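/- Let $T$ be a finite rooted directed binary tree (all edges point away from the root, every vertex that is not a leaf has exactly two children), let $O$ be its set of leaves, and let the leaves be labeled bijectively by $[n]=\{1,\dots,n\}$. Write $V$ and $E$ for the vertices and edges of $T$. For $i,j\in V$ a trek between $i$ and $j$ is a simple path $P$ from $i$ to $j$ in the underlying undirected tree that contains no two distinct edges $a\to k$, $b\to k$ with the same head; $\mathrm{top}(P)$ is the unique vertex of $P$ that is not the head of an edge of $P$ (for $i=j$ the only trek is the empty one, with top $i$). Let $$\phi_T:\mathbb{C}[\sigma_{ij}\mid i,j\in V,\ \sigma_{ij}=\sigma_{ji}]\to\mathbb{C}[a_v,\lambda_{kl}\mid v\in V,\ k\to l\in E],\qquad \sigma_{ij}\mapsto\sum_{P}a_{\mathrm{top}(P)}\prod_{k\to l\in P}\lambda_{kl},$$ where the sum is over the treks $P$ between $i$ and $j$, let $I_T=\ker\phi_T$, and let $I_{T,O}=I_T\cap\mathbb{C}[\sigma_{ij}\mid i,j\in O]$, regarded via the labeling as an ideal of $\mathbb{C}[\Sigma]=\mathbb{C}[\sigma_{ij}\mid 1\le i\le j\le n]$. Let $I_{2,n}\subset\mathbb{C}[\Sigma]$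 be the ideal of the Grassmannian $Gr_{2,n}$ in its Plücker embedding, that is, the ideal of all polynomials that vanish whenever the $\sigma_{ij}$, $i<j$, are the $2\times2$ minors of a $2\times n$ complex matrix (the diagonal coordinates $\sigma_{ii}$ being arbitrary). For $\omega\in\mathbb{R}^{\binom{n+1}{2}}$ let $\mathrm{in}_\omega(I)$ be the ideal generated by the initial forms (sums of the terms of maximal $\omega$-weight) of the elements of $I$; a sign vector $\tau\in\{\pm1\}^{\binom{n+1}{2}}$ acts by multiplying $\sigma_{ij}$ by $\tau_{ij}$. Then there are a weight vector $\omega\in\mathbb{R}^{\binom{n+1}{2}}$ and a sign vector $\tau\in\{\pm1\}^{\binom{n+1}{2}}$ such that $$I_{T,O}=\tau\cdot\mathrm{in}_\omega(I_{2,n}).$$ Moreover $I_{T,O}$ is a toric degeneration of $I_{2,n}$: it is a toric ideal (the kernel of a homomorphism from $\mathbb{C}[\Sigma]$ to a Laurent polynomial ring over $\mathbb{C}$ that sends each $\sigma_{ij}$ to a Laurent monomial), and there is an ideal $F\subset\mathbb{C}[t][\Sigma]$, homogeneous in the $\sigma_{ij}$, such that $\mathbb{C}[t][\Sigma]/F$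 is flat over $\mathbb{C}[t]$, the specialization of $F$ at $t=0$ is $I_{T,O}$, and for every $c\in\mathbb{C}\setminus\{0\}$ the specialization of $F$ at $t=c$ is obtained from $I_{2,n}$ by multiplying the coordinates $\sigma_{ij}$ by nonzero constants. -/

import Mathlib

noncomputable section

namespace HiddenTree

open MvPolynomial

section Trek

variable {V : Type*} (G : Digraph V)

/-- A trek between `i` and `j` in the directed acyclic graph `G`: a simple path `path` from `i` to
`j` in the underlying undirected graph that contains no collider (no two distinct edges `a → k`,
`b → k` with the same head), recorded together with its topmost vertex `top`, the (unique) vertex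
of the path that is not the head of any edge of the path. -/
@[ext]
structure Trek (i j : V) where
  path : G.toSimpleGraphInclusive.Walk i j
  isPath : path.IsPath
  noCollider : ∀ a b k : V, G.Adj a k → G.Adj b k →
    s(a, k) ∈ path.edges → s(b, k) ∈ path.edges → a = b
  top : V
  top_mem : top ∈ path.support
  top_isTop : ∀ k : V, G.Adj k top → s(k, top) ∉ path.edges

/-- The directed edges of `G`. -/
abbrev Edge : Type _ := {e : V × V // G.Adj e.1 e.2}

/-- The indeterminates of the parameter ring: `a_v` for the vertices (`Sum.inl v`) and `λ_e` for
the edges (`Sum.inr e`). -/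
abbrev Param : Type _ := V ⊕ Edge G

variable {G}

/-- Reversal of treks. -/
def Trek.reverse {i j : V} (P : Trek G i j) : Trek G j i where
  path := P.path.reverse
  isPath := P.isPath.reverse
  noCollider a b k ha hb h₁ h₂ := by
    rw [SimpleGraph.Walk.edges_reverse, List.mem_reverse] at h₁ h₂
    exact P.noCollider a b k ha hb h₁ h₂
  top := P.top
  top_mem := by
    rw [SimpleGraph.Walk.support_reverse, List.mem_reverse]
    exact P.top_mem
  top_isTop k hk h := by
    rw [SimpleGraph.Walk.edges_reverse, List.mem_reverse] at h
    exact P.top_isTop k hk h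

/-- Reversal is a bijection between the treks from `i` to `j` and those from `j` to `i`. -/
def Trek.reverseEquiv (i j : V) : Trek G i j ≃ Trek G j i where
  toFun := Trek.reverse
  invFun := Trek.reverse
  left_inv P := by ext1 <;> simp [Trek.reverse]
  right_inv P := by ext1 <;> simp [Trek.reverse]

/-- The monomial `a_{top(P)} ∏_{k → l ∈ P} λ_{kl}` of a trek `P`. -/
def Trek.monomial {i j : V} (P : Trek G i j) : MvPolynomial (Param G) ℂ :=
  X (Sum.inl P.top) *
    ∏ᶠ (e : Edge G) (_ : s(e.1.1, e.1.2) ∈ P.path.edges), X (Sum.inr e)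

theorem Trek.monomial_reverse {i j : V} (P : Trek G i j) :
    P.reverse.monomial = P.monomial := by
  simp [Trek.monomial, Trek.reverse]

variable (G)

/-- The sum of the monomials of all treks between `i` and `j` (a finite sum if `V` is finite). -/
def trekSum (i j : V) : MvPolynomial (Param G) ℂ := ∑ᶠ P : Trek G i j, P.monomial

theorem trekSum_comm (i j : V) : trekSum G i j = trekSum G j i :=
  finsum_eq_of_bijective _ (Trek.reverseEquiv i j).bijective
    fun P => (Trek.monomial_reverse P).symm

/-- The trek rule homomorphism `φ_G : ℂ[σ_{ij}] → ℂ[a_i, λ_{ij}]`. The covariance indeterminates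
`σ_{ij} = σ_{ji}` are indexed by the unordered pairs of (not necessarily distinct) vertices. -/
def trekHom : MvPolynomial (Sym2 V) ℂ →ₐ[ℂ] MvPolynomial (Param G) ℂ :=
  aeval (Sym2.lift ⟨trekSum G, trekSum_comm G⟩)

/-- The ideal `I_G` of the Gaussian Bayesian network of `G`. -/
def networkIdeal : Ideal (MvPolynomial (Sym2 V) ℂ) := RingHom.ker (trekHom G)

/-- The ideal `I_{G,O} = I_G ∩ ℂ[σ_{ij} | i, j ∈ O]` of the network with observed vertices given by
the (injective) family `obs`, as an ideal of `ℂ[σ_{ij} | i, j ∈ O]`. -/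
def observedIdeal {O : Type*} (obs : O → V) : Ideal (MvPolynomial (Sym2 O) ℂ) :=
  (networkIdeal G).comap (rename (Sym2.map obs) : MvPolynomial (Sym2 O) ℂ →ₐ[ℂ] _)

/-- A leaf: a vertex without children. -/
def IsLeaf (v : V) : Prop := ∀ w, ¬ G.Adj v w

/-- A rooted directed binary tree: all edges point away from a root, and every vertex that is not
a leaf has exactly two children. -/
structure IsRootedBinaryTree : Prop where
  exists_root : ∃ r : V, (∀ v, ¬ G.Adj v r) ∧ ∀ v, Relation.ReflTransGen G.Adj r v
  parent_unique : ∀ v a b : V, G.Adj a v → G.Adj b v → a = b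
  binary : ∀ v : V, ¬ IsLeaf G v → {w | G.Adj v w}.ncard = 2

end Trek

section Initial

variable {ι : Type*}

open Classical in
/-- The initial form of `f`: the sum of its terms of maximal `ω`-weight. -/
def initialForm (ω : ι → ℝ) (f : MvPolynomial ι ℂ) : MvPolynomial ι ℂ :=
  ∑ u ∈ f.support with ∀ v ∈ f.support, Finsupp.weight ω v ≤ Finsupp.weight ω u,
    monomial u (coeff u f)

/-- The initial ideal `in_ω(I)`. -/
def initialIdeal (ω : ι → ℝ) (I : Ideal (MvPolynomial ι ℂ)) : Ideal (MvPolynomial ι ℂ) :=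
  Ideal.span (initialForm ω '' I)

/-- The ideal obtained from `I` by multiplying each coordinate `x_i` by the unit `c_i`. -/
def rescale (c : ι → ℂˣ) (I : Ideal (MvPolynomial ι ℂ)) : Ideal (MvPolynomial ι ℂ) :=
  I.map (aeval fun i => C (c i : ℂ) * X i : MvPolynomial ι ℂ →ₐ[ℂ] MvPolynomial ι ℂ)

/-- The action of a sign vector on ideals. -/
def signAct (τ : ι → ℤˣ) (I : Ideal (MvPolynomial ι ℂ)) : Ideal (MvPolynomial ι ℂ) :=
  rescale (fun i => Units.map (Int.castRingHom ℂ : ℤ →* ℂ) (τ i)) I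

/-- A toric ideal: the kernel of a homomorphism to a Laurent polynomial ring
`ℂ[t₁^{±1}, …, t_m^{±1}]` that sends each indeterminate to a Laurent monomial. -/
def IsToricIdeal (J : Ideal (MvPolynomial ι ℂ)) : Prop :=
  ∃ (m : ℕ) (A : ι → Fin m → ℤ),
    J = RingHom.ker (aeval fun i => AddMonoidAlgebra.single (A i) 1 :
      MvPolynomial ι ℂ →ₐ[ℂ] AddMonoidAlgebra ℂ (Fin m → ℤ))

/-- The ideal of the fibre over the point `c` of the affine line of a family of closed subschemes
of affine space given by an ideal of `ℂ[t][x_i]`. -/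
def fiberIdeal (F : Ideal (MvPolynomial ι (Polynomial ℂ))) (c : ℂ) : Ideal (MvPolynomial ι ℂ) :=
  F.map (MvPolynomial.map (Polynomial.evalRingHom c))

/-- `J` is a toric degeneration of the homogeneous ideal `I`: `J` is toric, and there is a
homogeneous ideal of `ℂ[t][x_i]` defining a family, flat over the affine line, whose fibre over
`0` is defined by `J` and whose fibre over every `c ≠ 0` is defined by `I` up to a rescaling of the
coordinates. -/
def IsToricDegeneration (I J : Ideal (MvPolynomial ι ℂ)) : Prop :=
  IsToricIdeal J ∧
    ∃ F : Ideal (MvPolynomial ι (Polynomial ℂ)),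
      (∀ f ∈ F, ∀ d : ℕ, homogeneousComponent d f ∈ F) ∧
      Module.Flat (Polynomial ℂ) (MvPolynomial ι (Polynomial ℂ) ⧸ F) ∧
      (∀ c : ℂ, c ≠ 0 → ∃ u : ι → ℂˣ, fiberIdeal F c = rescale u I) ∧
      fiberIdeal F 0 = J

end Initial

/-- The affine cone over the Grassmannian `Gr_{2,n}` in its Plücker embedding: the coordinates
`σ_{ij}`, `i < j`, are the `2 × 2` minors of a `2 × n` matrix. The ambient space has in addition the
diagonal coordinates `σ_{ii}`, which are free. -/
def grassmannianCone (n : ℕ) : Set (Sym2 (Fin n) → ℂ) :=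
  {p | ∃ A : Matrix (Fin 2) (Fin n) ℂ, ∀ i j : Fin n, i < j →
    p s(i, j) = (A.submatrix id ![i, j]).det}

/-- The ideal `I_{2,n}` of the Grassmannian `Gr_{2,n}` in `ℂ[σ_{ij} | i ≤ j]`. -/
def grassmannianIdeal (n : ℕ) : Ideal (MvPolynomial (Sym2 (Fin n)) ℂ) :=
  vanishingIdeal ℂ (grassmannianCone n)

end HiddenTree

end

/-!
The trek between two observed vertices is unique, so `φ_T` restricts to a monomial map and its
kernel is toric; since equal images can be connected by swapping partners across an edge, lowest
branching points first, it is generated by the quadrics `σ_ac σ_bd - σ_ad σ_bc` for the vertices `l`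
of the tree that lie above `a`, `b` but not above `c`, `d`. Draw the tree in the plane and take each
Plücker coordinate with its columns in planar order, which is a change of signs. Then each of the
quadrics is completed to a three-term Plücker relation by `± σ_ab σ_cd`, and this term has smaller
weight as soon as the weight of `σ_ij` strictly decreases when the branching point of `i` and `j`
moves away from the root. Hence the kernel is contained in the initial ideal. Conversely, over the
field of rational functions in the parameters there is a matrix of polynomials in one variable whose
signed minors have degree at most the weight, and have the trek monomials as coefficients in that
degree. A relation among the minors vanishes on this matrix, and comparing top coefficients shows
that its initial form lies in the kernel of `φ_T`. The flat family is the Gröbner degeneration for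
the same weight.
-/

noncomputable section

namespace HiddenTree

open MvPolynomial

section InitialIdeal

variable {ι : Type*} {w : ι → ℕ} {I : Ideal (MvPolynomial ι ℂ)}

theorem weight_natCast (w : ι → ℕ) (u : ι →₀ ℕ) :
    Finsupp.weight (fun i => (w i : ℝ)) u = (Finsupp.weight w u : ℝ) := by
  simp [Finsupp.weight_apply, Finsupp.sum]

theorem initialForm_natCast (w : ι → ℕ) (f : MvPolynomial ι ℂ) :
    initialForm (fun i => (w i : ℝ)) f =
      weightedHomogeneousComponent w (weightedTotalDegree w f) f := by
  classical
  rw [initialForm, weightedHomogeneousComponent_apply]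
  refine Finset.sum_congr (Finset.filter_congr fun u hu => ?_) fun _ _ => rfl
  simp only [weight_natCast, Nat.cast_le]
  exact ⟨fun h => (le_weightedTotalDegree w hu).antisymm (Finset.sup_le h),
    fun h v hv => h ▸ le_weightedTotalDegree w hv⟩

theorem weightedHomogeneousComponent_mem_initialIdeal {f : MvPolynomial ι ℂ} (hf : f ∈ I) {m : ℕ}
    (hm : weightedTotalDegree w f ≤ m) :
    weightedHomogeneousComponent w m f ∈ initialIdeal (fun i => (w i : ℝ)) I := by
  classical
  rcases hm.eq_or_lt with rfl | hm
  · exact initialForm_natCast w f ▸ Ideal.subset_span ⟨f, hf, rfl⟩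
  · rw [weightedHomogeneousComponent_eq_zero' _ _ fun u hu =>
      ((le_weightedTotalDegree w hu).trans_lt hm).ne]
    exact zero_mem _

theorem mem_initialIdeal_of_add_mem {p q : MvPolynomial ι ℂ} {a b : ℕ}
    (hp : IsWeightedHomogeneous w p a) (hq : IsWeightedHomogeneous w q b) (hba : b < a)
    (hpq : p + q ∈ I) : p ∈ initialIdeal (fun i => (w i : ℝ)) I := by
  have hdeg : weightedTotalDegree w (p + q) ≤ a := by
    refine Finset.sup_le fun u hu => ?_
    have hu : coeff u p ≠ 0 ∨ coeff u q ≠ 0 := by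
      rw [mem_support_iff, coeff_add] at hu
      contrapose! hu
      rw [hu.1, hu.2, add_zero]
    rcases hu with h | h
    exacts [(hp h).le, (hq h).trans_le hba.le]
  have := weightedHomogeneousComponent_mem_initialIdeal hpq hdeg
  rwa [map_add, hp.weightedHomogeneousComponent_same,
    hq.weightedHomogeneousComponent_ne _ hba.ne', add_zero] at this

end InitialIdeal

section Scale

variable {ι R : Type*} [CommSemiring R] (c : ι → Rˣ)

/-- The automorphism of the polynomial ring that multiplies each `x_i` by the unit `c_i`. -/
def scaleEquiv : MvPolynomial ι R ≃ₐ[R] MvPolynomial ι R :=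
  AlgEquiv.ofAlgHom (aeval fun i => C (c i : R) * X i) (aeval fun i => C (↑(c i)⁻¹ : R) * X i)
    (algHom_ext fun i => by simp [← mul_assoc, ← C_mul])
    (algHom_ext fun i => by simp [← mul_assoc, ← C_mul])

@[simp]
theorem scaleEquiv_X (i : ι) : scaleEquiv c (X i) = C (c i : R) * X i := aeval_X _ i

@[simp]
theorem scaleEquiv_C (a : R) : scaleEquiv c (C a) = C a := (scaleEquiv c).commutes a

theorem scaleEquiv_monomial (u : ι →₀ ℕ) (a : R) :
    scaleEquiv c (monomial u a) = monomial u ((u.prod fun i k => (c i : R) ^ k) * a) := by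
  rw [monomial_eq, monomial_eq, map_mul, scaleEquiv_C, map_finsuppProd]
  simp only [map_pow, scaleEquiv_X, mul_pow, Finsupp.prod_mul, C_mul, map_finsuppProd]
  ring

theorem coeff_scaleEquiv (u : ι →₀ ℕ) (f : MvPolynomial ι R) :
    coeff u (scaleEquiv c f) = (u.prod fun i k => (c i : R) ^ k) * coeff u f := by
  classical
  induction f using MvPolynomial.induction_on' with
  | monomial v a =>
    rw [scaleEquiv_monomial, coeff_monomial, coeff_monomial]
    split_ifs with h
    · rw [h]
    · rw [mul_zero]
  | add p q hp hq => rw [map_add, coeff_add, coeff_add, hp, hq, mul_add]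

theorem scaleEquiv_scaleEquiv (c d : ι → Rˣ) (f : MvPolynomial ι R) :
    scaleEquiv c (scaleEquiv d f) = scaleEquiv (c * d) f := by
  ext u
  simp only [coeff_scaleEquiv, Pi.mul_apply, Units.val_mul, mul_pow, Finsupp.prod_mul, mul_assoc]

theorem scaleEquiv_inv_scaleEquiv (f : MvPolynomial ι R) :
    scaleEquiv c⁻¹ (scaleEquiv c f) = f := by
  ext u
  rw [scaleEquiv_scaleEquiv, inv_mul_cancel, coeff_scaleEquiv]
  simp only [Pi.one_apply, Units.val_one, one_pow, Finsupp.prod, Finset.prod_const_one, one_mul]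

theorem support_scaleEquiv (f : MvPolynomial ι R) : (scaleEquiv c f).support = f.support := by
  ext u
  have hu : IsUnit (u.prod fun i k => (c i : R) ^ k) :=
    IsUnit.prod_iff.2 fun i _ => (c i).isUnit.pow _
  rw [mem_support_iff, mem_support_iff, coeff_scaleEquiv, ne_eq, hu.mul_right_eq_zero]

theorem aeval_scaleEquiv {A : Type*} [CommSemiring A] [Algebra R A] (p : ι → A)
    (f : MvPolynomial ι R) :
    aeval p (scaleEquiv c f) = aeval (fun i => algebraMap R A (c i) * p i) f := by
  have hcomp : (aeval p).comp (scaleEquiv c : MvPolynomial ι R →ₐ[R] MvPolynomial ι R) =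
      aeval fun i => algebraMap R A (c i) * p i := by
    refine MvPolynomial.algHom_ext fun i => ?_
    simp [scaleEquiv_X]
  exact DFunLike.congr_fun hcomp f

end Scale

section Rescale

variable {ι : Type*} (c : ι → ℂˣ) {I : Ideal (MvPolynomial ι ℂ)}

theorem mem_rescale_iff {f : MvPolynomial ι ℂ} : f ∈ rescale c I ↔ scaleEquiv c⁻¹ f ∈ I := by
  have h : f ∈ rescale c I ↔ ∃ g ∈ I, scaleEquiv c g = f :=
    Ideal.mem_map_of_equiv (scaleEquiv c) f
  rw [h]
  constructor
  · rintro ⟨g, hg, rfl⟩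
    rwa [scaleEquiv_inv_scaleEquiv]
  · intro hf
    exact ⟨_, hf, by simpa only [inv_inv] using scaleEquiv_inv_scaleEquiv c⁻¹ f⟩

theorem rescale_rescale (c d : ι → ℂˣ) : rescale c (rescale d I) = rescale (c * d) I := by
  ext f
  rw [mem_rescale_iff, mem_rescale_iff, mem_rescale_iff, scaleEquiv_scaleEquiv, mul_inv_rev]

theorem initialForm_scaleEquiv (ω : ι → ℝ) (f : MvPolynomial ι ℂ) :
    initialForm ω (scaleEquiv c f) = scaleEquiv c (initialForm ω f) := by
  simp only [initialForm, support_scaleEquiv, map_sum, scaleEquiv_monomial, coeff_scaleEquiv]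

theorem initialIdeal_rescale (ω : ι → ℝ) :
    initialIdeal ω (rescale c I) = rescale c (initialIdeal ω I) := by
  have hrescale : (rescale c I : Set (MvPolynomial ι ℂ)) = scaleEquiv c '' I := by
    ext f
    exact Ideal.mem_map_of_equiv (scaleEquiv c) f
  have hspan : rescale c (initialIdeal ω I) = Ideal.span (scaleEquiv c '' (initialForm ω '' I)) :=
    Ideal.map_span (scaleEquiv c) _
  rw [hspan, initialIdeal, hrescale, Set.image_image, Set.image_image]
  simp only [initialForm_scaleEquiv]

theorem homogeneousComponent_mem_rescale {c : ι → ℂˣ}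
    (hI : ∀ f ∈ I, ∀ d : ℕ, homogeneousComponent d f ∈ I) {f : MvPolynomial ι ℂ}
    (hf : f ∈ rescale c I) (d : ℕ) : homogeneousComponent d f ∈ rescale c I := by
  rw [mem_rescale_iff] at hf ⊢
  have hcomm : scaleEquiv c⁻¹ (homogeneousComponent d f) =
      homogeneousComponent d (scaleEquiv c⁻¹ f) := by
    ext u
    simp only [coeff_scaleEquiv, coeff_homogeneousComponent, mul_ite, mul_zero]
  exact hcomm ▸ hI _ hf d

theorem mem_signAct_iff {τ : ι → ℤˣ} {f : MvPolynomial ι ℂ} :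
    f ∈ signAct τ I ↔
      scaleEquiv (fun i => Units.map (Int.castRingHom ℂ : ℤ →* ℂ) (τ i)) f ∈ I := by
  have hinv : (fun i => Units.map (Int.castRingHom ℂ : ℤ →* ℂ) (τ i))⁻¹ =
      fun i => Units.map (Int.castRingHom ℂ : ℤ →* ℂ) (τ i) := by
    ext i
    rw [Pi.inv_apply, ← map_inv, Int.units_inv_eq_self]
  rw [signAct, mem_rescale_iff, hinv]

theorem signAct_initialIdeal (τ : ι → ℤˣ) (ω : ι → ℝ) :
    signAct τ (initialIdeal ω I) = initialIdeal ω (signAct τ I) :=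
  (initialIdeal_rescale _ _).symm

end Rescale

section GroebnerFamily

variable {ι R : Type*} [CommRing R] (w : ι → ℕ) {I : Ideal (MvPolynomial ι R)}

/-- The substitution `x_i ↦ t ^ (w i) x_i`, with values in the polynomials in `t` over `R[x]`. -/
def weightSubst : MvPolynomial ι (Polynomial R) →+* Polynomial (MvPolynomial ι R) :=
  eval₂Hom (Polynomial.mapRingHom C) fun i => Polynomial.C (X i) * Polynomial.X ^ w i

variable (I) in
/-- The Gröbner degeneration of `I` in direction `w`: the ideal of the closure of the family of the
varieties `t ^ (-w) V(I)`, `t ≠ 0`. -/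
def groebnerFamily : Ideal (MvPolynomial ι (Polynomial R)) :=
  (I.map Polynomial.C).comap (weightSubst w)

theorem mem_groebnerFamily_iff {g : MvPolynomial ι (Polynomial R)} :
    g ∈ groebnerFamily w I ↔ ∀ m, (weightSubst w g).coeff m ∈ I :=
  Ideal.mem_map_C_iff

theorem weightSubst_monomial (u : ι →₀ ℕ) (p : Polynomial R) :
    weightSubst w (monomial u p) =
      p.map C * Polynomial.C (monomial u 1) * Polynomial.X ^ Finsupp.weight w u := by
  rw [weightSubst, coe_eval₂Hom, eval₂_monomial, Polynomial.coe_mapRingHom, mul_assoc,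
    monomial_eq, C_1, one_mul, map_finsuppProd, Finsupp.weight_apply, Finsupp.sum,
    ← Finset.prod_pow_eq_pow_sum, Finsupp.prod, Finsupp.prod, ← Finset.prod_mul_distrib]
  simp only [mul_pow, map_pow, ← pow_mul, smul_eq_mul, mul_comm]

theorem coeff_coeff_weightSubst (g : MvPolynomial ι (Polynomial R)) (m : ℕ) (u : ι →₀ ℕ) :
    coeff u ((weightSubst w g).coeff m) =
      if Finsupp.weight w u ≤ m then (coeff u g).coeff (m - Finsupp.weight w u) else 0 := by
  classical
  induction g using MvPolynomial.induction_on' with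
  | monomial v p =>
    rw [weightSubst_monomial, Polynomial.coeff_mul_X_pow', coeff_monomial]
    rcases eq_or_ne v u with rfl | hvu
    · rw [if_pos rfl]
      split_ifs <;> simp
    · rw [if_neg hvu]
      split_ifs <;> simp [hvu]
  | add p q hp hq =>
    simp only [map_add, Polynomial.coeff_add, coeff_add, hp, hq]
    split_ifs <;> simp

theorem homogeneousComponent_mem_groebnerFamily
    (hI : ∀ f ∈ I, ∀ d : ℕ, homogeneousComponent d f ∈ I)
    {g : MvPolynomial ι (Polynomial R)} (hg : g ∈ groebnerFamily w I) (d : ℕ) :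
    homogeneousComponent d g ∈ groebnerFamily w I := by
  rw [mem_groebnerFamily_iff] at hg ⊢
  intro m
  have hcomm : (weightSubst w (homogeneousComponent d g)).coeff m =
      homogeneousComponent d ((weightSubst w g).coeff m) := by
    ext u
    simp only [coeff_coeff_weightSubst, coeff_homogeneousComponent]
    split_ifs <;> simp
  exact hcomm ▸ hI _ (hg m) d

theorem eval_weightSubst (c : Rˣ) (g : MvPolynomial ι (Polynomial R)) :
    (weightSubst w g).eval (C (c : R)) =
      scaleEquiv (fun i => c ^ w i) (map (Polynomial.evalRingHom (c : R)) g) := by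
  have h : (Polynomial.evalRingHom (C (c : R))).comp (weightSubst w) =
      (scaleEquiv fun i => c ^ w i : MvPolynomial ι R →+* MvPolynomial ι R).comp
        (map (Polynomial.evalRingHom (c : R))) := by
    refine MvPolynomial.ringHom_ext (fun p => ?_) fun i => ?_
    · simp only [RingHom.comp_apply, RingHom.coe_coe, weightSubst, coe_eval₂Hom, eval₂_C, map_C,
        Polynomial.coe_mapRingHom, Polynomial.coe_evalRingHom, Polynomial.eval_map,
        Polynomial.eval₂_at_apply, scaleEquiv_C]
    · simp only [RingHom.comp_apply, RingHom.coe_coe, weightSubst, coe_eval₂Hom, eval₂_X, map_X,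
        Polynomial.coe_evalRingHom, Polynomial.eval_mul, Polynomial.eval_C, Polynomial.eval_pow,
        Polynomial.eval_X, scaleEquiv_X, Units.val_pow_eq_pow_val, C_pow, mul_comm]
  exact RingHom.congr_fun h g

/-- The homogenization of `f` with respect to the weight `w` by means of the variable `t`. -/
def weightHomogenization (f : MvPolynomial ι R) : MvPolynomial ι (Polynomial R) :=
  ∑ u ∈ f.support, monomial u
    (Polynomial.C (coeff u f) * Polynomial.X ^ (weightedTotalDegree w f - Finsupp.weight w u))

theorem weightSubst_weightHomogenization (f : MvPolynomial ι R) :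
    weightSubst w (weightHomogenization w f) =
      Polynomial.C f * Polynomial.X ^ weightedTotalDegree w f := by
  have hterm : ∀ u ∈ f.support, weightSubst w (monomial u (Polynomial.C (coeff u f) *
      Polynomial.X ^ (weightedTotalDegree w f - Finsupp.weight w u))) =
      Polynomial.C (monomial u (coeff u f)) * Polynomial.X ^ weightedTotalDegree w f := by
    intro u hu
    have hmonomial : monomial u (coeff u f) = C (coeff u f) * monomial u 1 := by
      rw [C_mul_monomial, mul_one]
    rw [weightSubst_monomial, ← Nat.sub_add_cancel (le_weightedTotalDegree w hu), pow_add,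
      Nat.sub_add_cancel (le_weightedTotalDegree w hu), hmonomial]
    simp only [Polynomial.map_mul, Polynomial.map_C, Polynomial.map_pow, Polynomial.map_X, map_mul]
    ring
  rw [weightHomogenization, map_sum, Finset.sum_congr rfl hterm, ← Finset.sum_mul, ← map_sum,
    support_sum_monomial_coeff]

theorem map_eval_zero_weightHomogenization (f : MvPolynomial ι R) :
    map (Polynomial.evalRingHom 0) (weightHomogenization w f) =
      weightedHomogeneousComponent w (weightedTotalDegree w f) f := by
  classical
  rw [weightedHomogeneousComponent_apply, Finset.sum_filter, weightHomogenization, map_sum]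
  refine Finset.sum_congr rfl fun u hu => ?_
  have hiff : weightedTotalDegree w f - Finsupp.weight w u = 0 ↔
      Finsupp.weight w u = weightedTotalDegree w f := by
    rw [Nat.sub_eq_zero_iff_le, (le_weightedTotalDegree w hu).ge_iff_eq]
  simp only [map_monomial, map_mul, map_pow, Polynomial.coe_evalRingHom, Polynomial.eval_C,
    Polynomial.eval_X, zero_pow_eq, hiff, mul_ite, mul_one, mul_zero, apply_ite (monomial u),
    map_zero]

theorem weightHomogenization_mem_groebnerFamily {f : MvPolynomial ι R} (hf : f ∈ I) :
    weightHomogenization w f ∈ groebnerFamily w I := by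
  rw [groebnerFamily, Ideal.mem_comap, weightSubst_weightHomogenization]
  exact Ideal.mul_mem_right _ _ (Ideal.mem_map_of_mem _ hf)

end GroebnerFamily

section ToricDegeneration

variable {ι : Type*} (w : ι → ℕ)

theorem mem_map_C_of_map_mul_mem {k A : Type*} [Field k] [CommRing A] [Algebra k A] {J : Ideal A}
    {p : Polynomial k} (hp : p ≠ 0) {h : Polynomial A}
    (hph : p.map (algebraMap k A) * h ∈ J.map Polynomial.C) : h ∈ J.map Polynomial.C := by
  rcases subsingleton_or_nontrivial (A ⧸ J) with hJ | hJ
  · rw [Ideal.Quotient.subsingleton_iff.1 hJ, Ideal.map_top]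
    trivial
  have hker : RingHom.ker (Polynomial.mapRingHom (Ideal.Quotient.mk J)) = J.map Polynomial.C := by
    rw [Polynomial.ker_mapRingHom, Ideal.mk_ker]
  rw [← hker, RingHom.mem_ker, map_mul, Polynomial.coe_mapRingHom, Polynomial.map_map] at hph
  rw [← hker, RingHom.mem_ker]
  refine (mem_nonZeroDivisors_iff.1 (Polynomial.mem_nonZeroDivisors_of_leadingCoeff ?_)).1 _ hph
  rw [Polynomial.leadingCoeff_map]
  exact ((Polynomial.leadingCoeff_ne_zero.2 hp).isUnit.map _).mem_nonZeroDivisors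

theorem flat_quotient_groebnerFamily {k : Type*} [Field k] (I : Ideal (MvPolynomial ι k)) :
    Module.Flat (Polynomial k) (MvPolynomial ι (Polynomial k) ⧸ groebnerFamily w I) := by
  have : Module.IsTorsionFree (Polynomial k)
      (MvPolynomial ι (Polynomial k) ⧸ groebnerFamily w I) := by
    refine Module.isTorsionFree_iff_smul_eq_zero.2 fun p x hpx => ?_
    obtain ⟨g, rfl⟩ := Ideal.Quotient.mk_surjective x
    refine or_iff_not_imp_left.2 fun hp => ?_
    rw [← Ideal.Quotient.mkₐ_eq_mk (Polynomial k), ← map_smul, Ideal.Quotient.mkₐ_eq_mk,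
      Ideal.Quotient.eq_zero_iff_mem, smul_eq_C_mul, groebnerFamily, Ideal.mem_comap,
      map_mul] at hpx
    rw [Ideal.Quotient.eq_zero_iff_mem]
    refine mem_map_C_of_map_mul_mem hp ?_
    simpa [weightSubst] using hpx
  infer_instance

variable {I : Ideal (MvPolynomial ι ℂ)}

theorem fiberIdeal_groebnerFamily (c : ℂˣ) :
    fiberIdeal (groebnerFamily w I) c = rescale (fun i => c ^ w i)⁻¹ I := by
  apply le_antisymm
  · refine Ideal.map_le_iff_le_comap.2 fun g hg => ?_
    rw [Ideal.mem_comap, mem_rescale_iff, inv_inv, ← eval_weightSubst,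
      Polynomial.eval_eq_sum_range]
    exact sum_mem fun m _ => I.mul_mem_right _ ((mem_groebnerFamily_iff w).1 hg m)
  · refine Ideal.map_le_iff_le_comap.2 fun f hf => ?_
    have h := eval_weightSubst w c (weightHomogenization w f)
    rw [weightSubst_weightHomogenization, Polynomial.eval_mul, Polynomial.eval_C,
      Polynomial.eval_pow, Polynomial.eval_X, ← C_pow] at h
    have hmem : scaleEquiv (fun i => c ^ w i)⁻¹ (f * C ((c : ℂ) ^ weightedTotalDegree w f)) ∈
        fiberIdeal (groebnerFamily w I) c := by
      rw [h, scaleEquiv_inv_scaleEquiv]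
      exact Ideal.mem_map_of_mem _ (weightHomogenization_mem_groebnerFamily w hf)
    rw [map_mul, scaleEquiv_C] at hmem
    have hunit : IsUnit (C ((c : ℂ) ^ weightedTotalDegree w f) : MvPolynomial ι ℂ) :=
      (c.isUnit.pow _).map C
    exact (Ideal.mul_unit_mem_iff_mem (fiberIdeal _ _) hunit).1 hmem

theorem fiberIdeal_groebnerFamily_zero :
    fiberIdeal (groebnerFamily w I) 0 = initialIdeal (fun i => (w i : ℝ)) I := by
  apply le_antisymm
  · refine Ideal.map_le_iff_le_comap.2 fun g hg => ?_
    rw [Ideal.mem_comap, ← finsum_weightedHomogeneousComponent w (map (Polynomial.evalRingHom 0) g)]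
    refine finsum_induction (· ∈ initialIdeal _ I) (zero_mem _) (fun _ _ => add_mem)
      fun m => ?_
    have hdeg : weightedTotalDegree w ((weightSubst w g).coeff m) ≤ m := by
      refine Finset.sup_le fun u hu => ?_
      rw [mem_support_iff, coeff_coeff_weightSubst] at hu
      by_contra hm
      exact hu (if_neg hm)
    have hcomp : weightedHomogeneousComponent w m (map (Polynomial.evalRingHom 0) g) =
        weightedHomogeneousComponent w m ((weightSubst w g).coeff m) := by
      ext u
      simp only [coeff_weightedHomogeneousComponent, coeff_coeff_weightSubst, coeff_map]
      split_ifs with h₁ h₂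
      · simp [h₁, Polynomial.coeff_zero_eq_eval_zero]
      · exact absurd h₁.le h₂
      · rfl
    rw [hcomp]
    exact weightedHomogeneousComponent_mem_initialIdeal ((mem_groebnerFamily_iff w).1 hg m) hdeg
  · refine Ideal.span_le.2 ?_
    rintro _ ⟨f, hf, rfl⟩
    rw [initialForm_natCast, ← map_eval_zero_weightHomogenization]
    exact Ideal.mem_map_of_mem _ (weightHomogenization_mem_groebnerFamily w hf)

theorem isToricDegeneration_initialIdeal (w : ι → ℕ)
    (hI : ∀ f ∈ I, ∀ d : ℕ, homogeneousComponent d f ∈ I)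
    (htoric : IsToricIdeal (initialIdeal (fun i => (w i : ℝ)) I)) :
    IsToricDegeneration I (initialIdeal (fun i => (w i : ℝ)) I) :=
  ⟨htoric, groebnerFamily w I, fun _ hf d => homogeneousComponent_mem_groebnerFamily w hI hf d,
    flat_quotient_groebnerFamily w I, fun c hc => ⟨_, fiberIdeal_groebnerFamily w (Units.mk0 c hc)⟩,
    fiberIdeal_groebnerFamily_zero w⟩

theorem IsToricDegeneration.of_rescale {c : ι → ℂˣ} {J : Ideal (MvPolynomial ι ℂ)}
    (h : IsToricDegeneration (rescale c I) J) : IsToricDegeneration I J := by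
  obtain ⟨htoric, F, hhom, hflat, hfiber, hzero⟩ := h
  refine ⟨htoric, F, hhom, hflat, fun a ha => ?_, hzero⟩
  obtain ⟨u, hu⟩ := hfiber a ha
  exact ⟨u * c, hu.trans (rescale_rescale u c)⟩

theorem isToricDegeneration_initialIdeal_signAct (hI : ∀ f ∈ I, ∀ d, homogeneousComponent d f ∈ I)
    (τ : ι → ℤˣ) (w : ι → ℕ)
    (htoric : IsToricIdeal (initialIdeal (fun i => (w i : ℝ)) (signAct τ I))) :
    IsToricDegeneration I (initialIdeal (fun i => (w i : ℝ)) (signAct τ I)) :=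
  .of_rescale (isToricDegeneration_initialIdeal w
    (fun _ hf d => homogeneousComponent_mem_rescale hI hf d) htoric)

end ToricDegeneration

section LeadingCoeff

variable {ι R A : Type*} [CommSemiring R] [CommSemiring A] [Algebra R A] {w : ι → ℕ}
  {p : ι → Polynomial A}

theorem coeff_prod_sum_of_natDegree_le {s : Finset ι} (hp : ∀ i ∈ s, (p i).natDegree ≤ w i) :
    (∏ i ∈ s, p i).coeff (∑ i ∈ s, w i) = ∏ i ∈ s, (p i).coeff (w i) := by
  classical
  induction s using Finset.induction_on with
  | empty => simp
  | insert a s ha ih =>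
    obtain ⟨hpa, hps⟩ := Finset.forall_mem_insert _ _ _ |>.1 hp
    rw [Finset.prod_insert ha, Finset.sum_insert ha, Finset.prod_insert ha, ← ih hps]
    exact Polynomial.coeff_mul_add_eq_of_natDegree_le hpa
      ((Polynomial.natDegree_prod_le _ _).trans (Finset.sum_le_sum hps))

theorem coeff_aeval_eq_aeval_coeff (hp : ∀ i, (p i).natDegree ≤ w i) {f : MvPolynomial ι R} {m : ℕ}
    (hf : weightedTotalDegree w f ≤ m) :
    (aeval p f).coeff m =
      aeval (fun i => (p i).coeff (w i)) (weightedHomogeneousComponent w m f) := by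
  classical
  have hpow : ∀ (u : ι →₀ ℕ) (i : ι), (p i ^ u i).natDegree ≤ u i * w i := fun u i =>
    Polynomial.natDegree_pow_le.trans (Nat.mul_le_mul_left _ (hp i))
  rw [weightedHomogeneousComponent_apply, Finset.sum_filter, map_sum, aeval_def, eval₂_eq,
    Polynomial.finsetSum_coeff]
  refine Finset.sum_congr rfl fun u hu => ?_
  have hweight : Finsupp.weight w u = ∑ i ∈ u.support, u i * w i := Finsupp.weight_apply _ _
  rw [Polynomial.algebraMap_apply, Polynomial.coeff_C_mul]
  split_ifs with hm
  · rw [aeval_monomial, ← hm, hweight, coeff_prod_sum_of_natDegree_le fun i _ => hpow u i]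
    simp only [Polynomial.coeff_pow_of_natDegree_le (hp _), Finsupp.prod]
  · have hlt := ((le_weightedTotalDegree w hu).trans hf).lt_of_ne hm
    rw [Polynomial.coeff_eq_zero_of_natDegree_lt, mul_zero, map_zero]
    exact ((Polynomial.natDegree_prod_le _ _).trans
      (Finset.sum_le_sum fun i _ => hpow u i)).trans_lt (hweight ▸ hlt)

end LeadingCoeff

section TreeOrder

/-- An order in which the elements below any given element form a chain, such as the order by
ancestry of the vertices of a rooted tree. -/
def IsTreeOrder (V : Type*) [LE V] : Prop :=
  ∀ ⦃a b c : V⦄, a ≤ c → b ≤ c → a ≤ b ∨ b ≤ a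

variable {V : Type*}

theorem IsTreeOrder.eq_of_covBy [PartialOrder V] (h : IsTreeOrder V) {a b c : V} (hac : a ⋖ c)
    (hbc : b ⋖ c) : a = b := by
  rcases h hac.le hbc.le with hab | hba
  · exact (hac.eq_or_eq hab hbc.le).resolve_right hbc.ne |>.symm
  · exact (hbc.eq_or_eq hba hac.le).resolve_right hac.ne

variable [SemilatticeInf V]

theorem IsTreeOrder.inf_lt (h : IsTreeOrder V) {l a c : V} (ha : l ≤ a) (hc : ¬ l ≤ c) :
    a ⊓ c < l :=
  have hl : ¬ l ≤ a ⊓ c := fun hl => hc (hl.trans inf_le_right)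
  lt_of_le_not_ge ((h inf_le_left ha).resolve_right hl) hl

theorem IsTreeOrder.inf_eq_inf (h : IsTreeOrder V) {l a b c : V} (ha : l ≤ a) (hb : l ≤ b)
    (hc : ¬ l ≤ c) : a ⊓ c = b ⊓ c :=
  le_antisymm (le_inf ((h.inf_lt ha hc).le.trans hb) inf_le_right)
    (le_inf ((h.inf_lt hb hc).le.trans ha) inf_le_right)

theorem IsTreeOrder.inf_add_inf_lt (htree : IsTreeOrder V) {ω : V → ℕ} (hω : StrictAnti ω)
    {l a b c d : V} (ha : l ≤ a) (hb : l ≤ b) (hc : ¬ l ≤ c) (hd : ¬ l ≤ d) :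
    ω (a ⊓ b) + ω (c ⊓ d) < ω (a ⊓ c) + ω (b ⊓ d) := by
  rw [← htree.inf_eq_inf ha hb hd]
  have hac : a ⊓ c < a ⊓ b := (htree.inf_lt ha hc).trans_le (le_inf ha hb)
  have had : a ⊓ d < a ⊓ b := (htree.inf_lt ha hd).trans_le (le_inf ha hb)
  rcases htree (inf_le_left : a ⊓ c ≤ a) (inf_le_left : a ⊓ d ≤ a) with hle | hle
  · have := hω.antitone (le_inf inf_le_right (hle.trans inf_le_right) : a ⊓ c ≤ c ⊓ d)
    have := hω had
    omega
  · have := hω.antitone (le_inf (hle.trans inf_le_right) inf_le_right : a ⊓ d ≤ c ⊓ d)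
    have := hω hac
    omega

end TreeOrder

section RootedTree

variable {V : Type*} {T : Digraph V}

open Relation

theorem IsRootedBinaryTree.not_transGen_self (hT : IsRootedBinaryTree T) (v : V) :
    ¬ TransGen T.Adj v v := by
  obtain ⟨r, hr, hreach⟩ := hT.exists_root
  induction hreach v with
  | refl =>
    intro h
    obtain ⟨c, -, hc⟩ := TransGen.tail'_iff.1 h
    exact hr _ hc
  | tail _ huv ih =>
    intro h
    obtain ⟨c, hvc, hc⟩ := TransGen.tail'_iff.1 h
    obtain rfl := hT.parent_unique _ _ _ huv hc
    exact ih (TransGen.head'_iff.2 ⟨_, huv, hvc⟩)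

theorem IsRootedBinaryTree.exists_lowest_common_ancestor (hT : IsRootedBinaryTree T) (i j : V) :
    ∃ m, ∀ x, ReflTransGen T.Adj x m ↔ ReflTransGen T.Adj x i ∧ ReflTransGen T.Adj x j := by
  obtain ⟨r, -, hreach⟩ := hT.exists_root
  induction hreach i with
  | refl =>
    refine ⟨r, fun x => ⟨fun h => ⟨h, h.trans (hreach j)⟩, fun h => h.1⟩⟩
  | @tail p i _ hpi ih =>
    by_cases hij : ReflTransGen T.Adj i j
    · exact ⟨i, fun x => ⟨fun h => ⟨h, h.trans hij⟩, fun h => h.1⟩⟩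
    · obtain ⟨m, hm⟩ := ih
      refine ⟨m, fun x => ⟨fun h => ⟨((hm x).1 h).1.tail hpi, ((hm x).1 h).2⟩, ?_⟩⟩
      rintro ⟨hxi, hxj⟩
      rcases ReflTransGen.cases_tail hxi with rfl | ⟨c, hxc, hc⟩
      · exact absurd hxj hij
      · obtain rfl := hT.parent_unique _ _ _ hpi hc
        exact (hm x).2 ⟨hxc, hxj⟩

/-- The vertices of a rooted tree, ordered by ancestry; infima are lowest common ancestors. -/
abbrev IsRootedBinaryTree.semilatticeInf (hT : IsRootedBinaryTree T) : SemilatticeInf V where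
  le := ReflTransGen T.Adj
  le_refl _ := ReflTransGen.refl
  le_trans _ _ _ := ReflTransGen.trans
  le_antisymm a b hab hba := by
    rcases reflTransGen_iff_eq_or_transGen.1 hab with h | h
    · exact h.symm
    · exact absurd (h.trans_left hba) (hT.not_transGen_self a)
  inf i j := (hT.exists_lowest_common_ancestor i j).choose
  inf_le_left i j :=
    (((hT.exists_lowest_common_ancestor i j).choose_spec _).1 ReflTransGen.refl).1
  inf_le_right i j :=
    (((hT.exists_lowest_common_ancestor i j).choose_spec _).1 ReflTransGen.refl).2
  le_inf a i j hi hj := ((hT.exists_lowest_common_ancestor i j).choose_spec a).2 ⟨hi, hj⟩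

theorem IsRootedBinaryTree.isTreeOrder (hT : IsRootedBinaryTree T) :
    letI := hT.semilatticeInf
    IsTreeOrder V := by
  intro a b c hac hbc
  have hunique : Relator.RightUnique (Function.swap T.Adj) := fun x y z hy hz =>
    hT.parent_unique _ _ _ hy hz
  exact (ReflTransGen.total_of_right_unique hunique (reflTransGen_swap.2 hac)
    (reflTransGen_swap.2 hbc)).symm.imp reflTransGen_swap.1 reflTransGen_swap.1

theorem IsRootedBinaryTree.adj_iff_covBy (hT : IsRootedBinaryTree T) (a b : V) :
    letI := hT.semilatticeInf
    T.Adj a b ↔ a ⋖ b := by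
  let := hT.semilatticeInf
  have lt_of_adj : ∀ {x y : V}, T.Adj x y → x < y := fun {x y} hxy =>
    lt_of_le_of_ne (ReflTransGen.single hxy) fun h =>
      hT.not_transGen_self x (TransGen.single (h ▸ hxy))
  constructor
  · intro hab
    refine ⟨lt_of_adj hab, fun c hac hcb => ?_⟩
    rcases ReflTransGen.cases_tail hcb.le with rfl | ⟨p, hcp, hpb⟩
    · exact hcb.ne rfl
    · obtain rfl := hT.parent_unique _ _ _ hab hpb
      exact hac.not_ge hcp
  · intro hab
    rcases ReflTransGen.cases_head hab.le with rfl | ⟨c, hac, hcb⟩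
    · exact absurd rfl hab.ne
    · exact (hab.eq_or_eq (lt_of_adj hac).le hcb).resolve_left (lt_of_adj hac).ne' ▸ hac

theorem IsRootedBinaryTree.ncard_children_le (hT : IsRootedBinaryTree T) (v : V) :
    {w | T.Adj v w}.ncard ≤ 2 := by
  by_cases hv : IsLeaf T v
  · have hempty : {w | T.Adj v w} = ∅ := Set.eq_empty_of_forall_notMem hv
    rw [hempty, Set.ncard_empty]
    exact Nat.zero_le 2
  · exact (hT.binary v hv).le

end RootedTree

section Walks

variable {V : Type*} {T : Digraph V} [PartialOrder V]

open SimpleGraph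

theorem IsTreeOrder.sym2_eq_iff_xor (htree : IsTreeOrder V) {k l x y : V} (hkl : k ⋖ l)
    (hxy : x ⋖ y) : s(x, y) = s(k, l) ↔ Xor (l ≤ x) (l ≤ y) := by
  constructor
  · intro he
    rcases Sym2.eq_iff.1 he with ⟨rfl, rfl⟩ | ⟨rfl, rfl⟩
    · exact Or.inr ⟨le_rfl, hkl.lt.not_ge⟩
    · exact absurd hxy.le hkl.lt.not_ge
  · rintro (⟨hlx, hly⟩ | ⟨hly, hlx⟩)
    · exact absurd (hlx.trans hxy.le) hly
    · have hxl : x ≤ l := (htree hxy.le hly).resolve_right hlx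
      obtain rfl : l = y := (hxy.eq_or_eq hxl hly).resolve_left fun h => hlx h.le
      rw [htree.eq_of_covBy hxy hkl]

open Classical in
theorem odd_count_edges_iff (htree : IsTreeOrder V) (hadj : ∀ a b, T.Adj a b ↔ a ⋖ b) {k l : V}
    (hkl : k ⋖ l) {i j : V} (p : T.toSimpleGraphInclusive.Walk i j) :
    Odd (p.edges.count s(k, l)) ↔ Xor (l ≤ i) (l ≤ j) := by
  induction p with
  | nil => simp
  | @cons a b c h p ih =>
    have hstep : s(a, b) = s(k, l) ↔ Xor (l ≤ a) (l ≤ b) := by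
      rcases h.2 with hab | hba
      · exact htree.sym2_eq_iff_xor hkl ((hadj _ _).1 hab)
      · rw [Sym2.eq_swap, htree.sym2_eq_iff_xor hkl ((hadj _ _).1 hba), xor_comm]
    rw [Walk.edges_cons, List.count_cons]
    by_cases he : s(a, b) = s(k, l)
    · rw [if_pos (beq_iff_eq.2 he), Nat.odd_add_one, ih]
      have hxor := hstep.1 he
      unfold Xor at hxor ⊢
      tauto
    · rw [if_neg fun h => he (beq_iff_eq.1 h), add_zero, ih]
      have hxor := mt hstep.2 he
      unfold Xor at hxor ⊢
      tauto

theorem mem_edges_iff_of_isTrail (htree : IsTreeOrder V) (hadj : ∀ a b, T.Adj a b ↔ a ⋖ b)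
    {k l : V} (hkl : k ⋖ l) {i j : V} {p : T.toSimpleGraphInclusive.Walk i j} (hp : p.IsTrail) :
    s(k, l) ∈ p.edges ↔ Xor (l ≤ i) (l ≤ j) := by
  classical
  rw [← odd_count_edges_iff htree hadj hkl p]
  constructor
  · intro h
    rw [List.count_eq_one_of_mem hp.edges_nodup h]
    exact odd_one
  · intro h
    exact List.count_pos_iff.1 h.pos

theorem isAcyclic_toSimpleGraphInclusive (htree : IsTreeOrder V)
    (hadj : ∀ a b, T.Adj a b ↔ a ⋖ b) : T.toSimpleGraphInclusive.IsAcyclic := by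
  intro v c hc
  cases c with
  | nil => exact hc.ne_nil rfl
  | @cons _ b _ h p =>
    have hno : ∀ k l : V, T.Adj k l → s(k, l) ∉ (Walk.cons h p).edges := by
      intro k l hkl hmem
      rw [mem_edges_iff_of_isTrail htree hadj ((hadj _ _).1 hkl) hc.isTrail, xor_self] at hmem
      exact hmem
    rcases h.2 with hvb | hbv
    · exact hno _ _ hvb (by simp)
    · exact hno _ _ hbv (by simp [Sym2.eq_swap])

theorem reachable_of_le [Finite V] (hadj : ∀ a b, T.Adj a b ↔ a ⋖ b) {a b : V} (hab : a ≤ b) :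
    T.toSimpleGraphInclusive.Reachable a b := by
  induction b using WellFoundedLT.induction with
  | ind b ih =>
    rcases hab.eq_or_lt with rfl | hlt
    · rfl
    · obtain ⟨p, hap, hpb⟩ := exists_le_covBy_of_lt hlt
      exact (ih p hpb.lt hap).trans (Adj.reachable ⟨hpb.ne, Or.inl ((hadj _ _).2 hpb)⟩)

end Walks

section TrekSum

variable {V : Type*} {T : Digraph V} [SemilatticeInf V]

theorem exists_covBy_of_not_le [Finite V] {a b : V} (h : ¬ a ≤ b) : ∃ k, k ⋖ a :=
  let ⟨k, _, hk⟩ := exists_le_covBy_of_lt (inf_lt_left.2 h)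
  ⟨k, hk⟩

theorem Trek.top_eq_inf [Finite V] (htree : IsTreeOrder V) (hadj : ∀ a b, T.Adj a b ↔ a ⋖ b)
    {i j : V} (P : Trek T i j) : P.top = i ⊓ j := by
  classical
  have htrail : (P.path.takeUntil P.top P.top_mem).IsTrail := P.isPath.isTrail.takeUntil _
  have hsub := P.path.edges_takeUntil_subset_edges P.top_mem
  have htop_le : ∀ v, ¬ P.top ≤ v → ∃ k, k ⋖ P.top ∧ s(k, P.top) ∉ P.path.edges := fun v hv =>
    let ⟨k, hk⟩ := exists_covBy_of_not_le hv
    ⟨k, hk, P.top_isTop k ((hadj _ _).2 hk)⟩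
  have hti : P.top ≤ i := by
    by_contra hi
    obtain ⟨k, hk, hmem⟩ := htop_le i hi
    exact hmem (hsub ((mem_edges_iff_of_isTrail htree hadj hk htrail).2 (Or.inr ⟨le_rfl, hi⟩)))
  have htj : P.top ≤ j := by
    by_contra hj
    obtain ⟨k, hk, hmem⟩ := htop_le j hj
    exact hmem ((mem_edges_iff_of_isTrail htree hadj hk P.isPath.isTrail).2 (Or.inl ⟨hti, hj⟩))
  refine le_antisymm (le_inf hti htj) ?_
  by_contra hm
  obtain ⟨k, hk⟩ := exists_covBy_of_not_le hm
  have h := hsub ((mem_edges_iff_of_isTrail htree hadj hk htrail).2 (Or.inl ⟨inf_le_left, hm⟩))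
  rcases (mem_edges_iff_of_isTrail htree hadj hk P.isPath.isTrail).1 h with h' | h'
  exacts [h'.2 inf_le_right, h'.2 inf_le_left]

theorem nonempty_trek [Finite V] (htree : IsTreeOrder V) (hadj : ∀ a b, T.Adj a b ↔ a ⋖ b)
    (i j : V) : Nonempty (Trek T i j) := by
  obtain ⟨p, hp⟩ := ((reachable_of_le hadj inf_le_left).symm.trans
    (reachable_of_le hadj (inf_le_right : i ⊓ j ≤ j))).exists_isPath
  refine ⟨⟨p, hp, fun a b k ha hb _ _ => htree.eq_of_covBy ((hadj _ _).1 ha) ((hadj _ _).1 hb),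
    i ⊓ j, ?_, ?_⟩⟩
  · rcases (inf_le_left : i ⊓ j ≤ i).eq_or_lt with h | h
    · rw [h]
      exact p.start_mem_support
    · obtain ⟨c, hc, hci⟩ := exists_covBy_le_of_lt h
      have hcj : ¬ c ≤ j := fun hcj => hc.lt.not_ge (le_inf hci hcj)
      exact p.fst_mem_support_of_mem_edges
        ((mem_edges_iff_of_isTrail htree hadj hc hp.isTrail).2 (Or.inl ⟨hci, hcj⟩))
  · intro k hk hmem
    rcases (mem_edges_iff_of_isTrail htree hadj ((hadj _ _).1 hk) hp.isTrail).1 hmem with h | h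
    exacts [h.2 inf_le_right, h.2 inf_le_left]

open Classical in
theorem trekSum_eq [Finite V] [Fintype (Edge T)] (htree : IsTreeOrder V)
    (hadj : ∀ a b, T.Adj a b ↔ a ⋖ b) (i j : V) :
    trekSum T i j = X (Sum.inl (i ⊓ j)) *
      ∏ e : Edge T, if Xor (e.1.2 ≤ i) (e.1.2 ≤ j) then X (Sum.inr e) else 1 := by
  obtain ⟨P⟩ := nonempty_trek htree hadj i j
  have huniq : ∀ Q : Trek T i j, Q = P := by
    intro Q
    have h := ((isAcyclic_toSimpleGraphInclusive htree hadj).subsingleton_path i j).elim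
      (⟨Q.path, Q.isPath⟩ : T.toSimpleGraphInclusive.Path i j) ⟨P.path, P.isPath⟩
    ext1
    · exact congrArg Subtype.val h
    · rw [Q.top_eq_inf htree hadj, P.top_eq_inf htree hadj]
  rw [trekSum, finsum_eq_single _ P fun Q hQ => absurd (huniq Q) hQ, Trek.monomial,
    P.top_eq_inf htree hadj, finprod_eq_prod_of_fintype]
  congr 1
  refine Finset.prod_congr rfl fun e _ => ?_
  rw [finprod_eq_if]
  exact if_congr (mem_edges_iff_of_isTrail htree hadj ((hadj _ _).1 e.2) P.isPath.isTrail) rfl rfl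

end TrekSum

section MonomialMap

variable {σ κ : Type*}

/-- The homomorphism of polynomial rings that sends each `x_s` to the monomial `y ^ (A s)`. -/
def monomialMap (R : Type*) [CommSemiring R] (A : σ → κ →₀ ℕ) :
    MvPolynomial σ R →ₐ[R] MvPolynomial κ R :=
  aeval fun s => monomial (A s) 1

theorem monomialMap_monomial {R : Type*} [CommSemiring R] (A : σ → κ →₀ ℕ) (u : σ →₀ ℕ) (c : R) :
    monomialMap R A (monomial u c) = monomial (Finsupp.weight A u) c := by
  simp_rw [monomialMap, aeval_monomial, Finsupp.weight_apply, Finsupp.sum, Finsupp.prod,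
    algebraMap_eq, monomial_pow, one_pow, ← monomial_sum_one, C_mul_monomial, mul_one]

theorem weight_eq_of_mem_ker_monomialMap {R : Type*} [CommRing R] [Nontrivial R]
    {A : σ → κ →₀ ℕ} {u u' : σ →₀ ℕ}
    (h : monomial u (1 : R) - monomial u' 1 ∈ RingHom.ker (monomialMap R A)) :
    Finsupp.weight A u = Finsupp.weight A u' := by
  rw [RingHom.mem_ker, map_sub, monomialMap_monomial, monomialMap_monomial, sub_eq_zero] at h
  exact monomial_left_injective one_ne_zero h

theorem ker_monomialMap_le {R : Type*} [CommRing R] {A : σ → κ →₀ ℕ}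
    {K : Ideal (MvPolynomial σ R)}
    (hK : ∀ u u', Finsupp.weight A u = Finsupp.weight A u' → monomial u 1 - monomial u' 1 ∈ K) :
    RingHom.ker (monomialMap R A) ≤ K := by
  intro f hf
  -- A linear section of the monomial map on its image, modulo `K`.
  let r : (κ →₀ ℕ) → (σ →₀ ℕ) := Function.invFun (Finsupp.weight A)
  let L : MvPolynomial κ R →ₗ[R] MvPolynomial σ R :=
    (basisMonomials κ R).constr R fun m => monomial (r m) 1
  have hL : ∀ m c, L (monomial m c) = monomial (r m) c := by
    intro m c
    have := (basisMonomials κ R).constr_basis R (fun m => (monomial (r m) 1 : MvPolynomial σ R)) m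
    rw [coe_basisMonomials] at this
    rw [← mul_one c, ← smul_eq_mul, ← smul_monomial, map_smul, this, smul_monomial]
  have hg : ∀ g : MvPolynomial σ R, g - L (monomialMap R A g) ∈ K := by
    intro g
    induction g using MvPolynomial.induction_on' with
    | monomial u c =>
      rw [monomialMap_monomial, hL]
      have := K.mul_mem_left (C c)
        (hK u _ (Function.invFun_eq (f := Finsupp.weight A) ⟨u, rfl⟩).symm)
      rwa [mul_sub, C_mul_monomial, C_mul_monomial, mul_one] at this
    | add p q hp hq =>
      rw [map_add, map_add, add_sub_add_comm]
      exact K.add_mem hp hq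
  simpa only [RingHom.mem_ker.1 hf, map_zero, sub_zero] using hg f

theorem isToricIdeal_ker_monomialMap [Finite κ] (A : σ → κ →₀ ℕ) :
    IsToricIdeal (RingHom.ker (monomialMap ℂ A)) := by
  obtain ⟨m, ⟨e⟩⟩ := Finite.exists_equiv_fin κ
  let φ : (κ →₀ ℕ) →+ (Fin m → ℤ) :=
    { toFun := fun u k => (u (e.symm k) : ℤ)
      map_zero' := by ext; simp
      map_add' := fun u v => by ext; simp }
  have hφ : Function.Injective φ := by
    intro u v huv
    ext k
    simpa [φ] using congrFun huv (e k)
  refine ⟨m, fun s => φ (A s), ?_⟩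
  have hcomp : (aeval fun s => AddMonoidAlgebra.single (φ (A s)) 1 :
      MvPolynomial σ ℂ →ₐ[ℂ] AddMonoidAlgebra ℂ (Fin m → ℤ)) =
      (AddMonoidAlgebra.mapDomainAlgHom ℂ ℂ φ).comp (monomialMap ℂ A) := by
    refine MvPolynomial.algHom_ext fun s => ?_
    rw [aeval_X, AlgHom.comp_apply, monomialMap, aeval_X]
    exact (AddMonoidAlgebra.mapDomain_single).symm
  ext f
  rw [RingHom.mem_ker, RingHom.mem_ker, hcomp, AlgHom.comp_apply]
  refine ⟨fun hf => by rw [hf, map_zero], fun hf => ?_⟩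
  exact AddMonoidAlgebra.mapDomain_injective hφ (hf.trans (AddMonoidAlgebra.mapDomain_zero φ).symm)

theorem weight_apply_ne_zero_iff {A : σ → κ →₀ ℕ} {u : σ →₀ ℕ} {x : κ} :
    Finsupp.weight A u x ≠ 0 ↔ ∃ s, u s ≠ 0 ∧ A s x ≠ 0 := by
  simp [Finsupp.weight_apply, Finsupp.sum, Finsupp.finsetSum_apply, Finset.sum_eq_zero_iff]

end MonomialMap

section PathExp

variable {V : Type*} [SemilatticeInf V] [Finite V]

open Classical in
/-- The exponent of the monomial `a_{x ⊓ y} ∏ λ_v` of the path between two vertices `x`, `y` of a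
tree. The edge parameter `λ_v` is indexed by the head `v` of the edge, which lies on the path if and
only if `v` separates `x` from `y`. -/
def pathExp : Sym2 V → (V ⊕ V →₀ ℕ) :=
  Sym2.lift ⟨fun x y => Finsupp.equivFunOnFinite.symm (Sum.elim
    (fun v => if x ⊓ y = v then 1 else 0) fun v => if Xor (v ≤ x) (v ≤ y) then 1 else 0),
    fun x y => by simp_rw [inf_comm, xor_comm]⟩

open Classical in
theorem pathExp_mk_inl (x y v : V) :
    pathExp s(x, y) (Sum.inl v) = if x ⊓ y = v then 1 else 0 := rfl

open Classical in
theorem pathExp_mk_inr (x y v : V) :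
    pathExp s(x, y) (Sum.inr v) = if Xor (v ≤ x) (v ≤ y) then 1 else 0 := rfl

theorem pathExp_inl_ne_zero {s : Sym2 V} {v : V} : pathExp s (Sum.inl v) ≠ 0 ↔ s.inf = v := by
  induction s with | _ x y => simp [pathExp_mk_inl]

open Classical in
theorem monomial_pathExp {R : Type*} [CommSemiring R] [Fintype V] (x y : V) :
    (monomial (pathExp s(x, y)) 1 : MvPolynomial (V ⊕ V) R) =
      X (Sum.inl (x ⊓ y)) * ∏ v, if Xor (v ≤ x) (v ≤ y) then X (Sum.inr v) else 1 := by
  rw [monomial_eq, C_1, one_mul, Finsupp.prod_fintype _ _ fun _ => pow_zero _,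
    Fintype.prod_sum_type]
  simp only [pathExp_mk_inl, pathExp_mk_inr, pow_ite, pow_one, pow_zero, Finset.prod_ite_eq,
    Finset.mem_univ, if_true]

/-- The exponent of the image of `σ_{ij}` under the trek rule, for the observed vertices `ℓ`. -/
def observedExp {ι : Type*} (ℓ : ι → V) (s : Sym2 ι) : V ⊕ V →₀ ℕ := pathExp (s.map ℓ)

theorem observedIdeal_eq_ker_monomialMap {T : Digraph V} (htree : IsTreeOrder V)
    (hadj : ∀ a b, T.Adj a b ↔ a ⋖ b) {ι : Type*} (ℓ : ι → V) :
    observedIdeal T ℓ = RingHom.ker (monomialMap ℂ (observedExp ℓ)) := by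
  classical
  have := Fintype.ofFinite V
  have := Fintype.ofFinite (Edge T)
  have hhead : Function.Injective fun e : Edge T => e.1.2 := by
    rintro ⟨⟨a, c⟩, ha⟩ ⟨⟨b, _⟩, hb⟩ rfl
    obtain rfl := htree.eq_of_covBy ((hadj _ _).1 ha) ((hadj _ _).1 hb)
    rfl
  have hedge : ∀ v x y : V, Xor (v ≤ x) (v ≤ y) → ∃ e : Edge T, e.1.2 = v := by
    rintro v x y (⟨-, h⟩ | ⟨-, h⟩) <;> obtain ⟨k, hk⟩ := exists_covBy_of_not_le h <;>
      exact ⟨⟨(k, v), (hadj _ _).2 hk⟩, rfl⟩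
  have hcomp : ((rename (Sum.map id fun e : Edge T => e.1.2)).comp (trekHom T)).comp
      (rename (Sym2.map ℓ)) = monomialMap ℂ (observedExp ℓ) := by
    refine MvPolynomial.algHom_ext fun s => ?_
    induction s with | _ i j => ?_
    rw [AlgHom.comp_apply, rename_X, AlgHom.comp_apply, trekHom, aeval_X, monomialMap, aeval_X,
      observedExp, Sym2.map_mk, Sym2.lift_mk, monomial_pathExp]
    simp only [trekSum_eq htree hadj, map_mul, map_prod, rename_X, Sum.map_inl, id, apply_ite,
      Sum.map_inr, map_one]
    congr 1
    refine Fintype.prod_of_injective _ hhead _ _ (fun v hv => if_neg fun h => hv ?_) fun _ => rfl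
    exact hedge v _ _ h
  ext f
  rw [observedIdeal, networkIdeal, Ideal.mem_comap, RingHom.mem_ker, RingHom.mem_ker, ← hcomp,
    AlgHom.comp_apply, AlgHom.comp_apply]
  exact (map_eq_zero_iff _ (rename_injective _ (Function.injective_id.sumMap hhead))).symm

end PathExp

section PlanarTree

variable {V ι : Type*} [SemilatticeInf V]

/-- A family `ℓ` of pairwise incomparable vertices of a binary tree that is drawn in the plane:
`right v` is one of the children of `v` (or `v` itself, if `v` is childless), and of two members of
the family that branch at `v`, exactly one lies below `right v`. -/
structure IsPlanarTree (ℓ : ι → V) (right : V → V) : Prop where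
  isTreeOrder : IsTreeOrder V
  eq_of_le : ∀ {i j}, ℓ i ≤ ℓ j → i = j
  wcovBy_right : ∀ v, v ⩿ right v
  xor_right_le : ∀ {i j}, i ≠ j → Xor (right (ℓ i ⊓ ℓ j) ≤ ℓ i) (right (ℓ i ⊓ ℓ j) ≤ ℓ j)

theorem IsTreeOrder.exists_isPlanarTree [Finite V] (htree : IsTreeOrder V)
    (hbinary : ∀ v : V, {w | v ⋖ w}.ncard ≤ 2) {ℓ : ι → V} (hℓ : ∀ i j, ℓ i ≤ ℓ j → i = j) :
    ∃ right, IsPlanarTree ℓ right := by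
  have hright : ∀ v : V, ∃ w, v ⩿ w ∧ ∀ c, v ⋖ c → v ⋖ w := by
    intro v
    by_cases hv : ∃ w, v ⋖ w
    · exact ⟨hv.choose, hv.choose_spec.wcovBy, fun _ _ => hv.choose_spec⟩
    · exact ⟨v, WCovBy.rfl, fun c hc => absurd ⟨c, hc⟩ hv⟩
  choose right hwcovBy hcovBy using hright
  refine ⟨right, htree, fun {i j} => hℓ i j, hwcovBy, fun {i j} hij => ?_⟩
  obtain ⟨c, hc, hci⟩ := exists_covBy_le_of_lt (inf_lt_left.2 (mt (hℓ i j) hij))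
  obtain ⟨d, hd, hdj⟩ := exists_covBy_le_of_lt (inf_lt_right.2 (mt (hℓ j i) hij.symm))
  have hbranch : ∀ w, ℓ i ⊓ ℓ j ⋖ w → w ≤ ℓ i → ¬ w ≤ ℓ j := fun w hw hwi hwj =>
    hw.lt.not_ge (le_inf hwi hwj)
  have hcd : c ≠ d := fun e => hbranch c hc hci (e ▸ hdj)
  have hr := hcovBy _ c hc
  have hright_eq : right (ℓ i ⊓ ℓ j) = c ∨ right (ℓ i ⊓ ℓ j) = d := by
    by_contra! hne
    exact (hbinary (ℓ i ⊓ ℓ j)).not_gt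
      ((Set.two_lt_ncard (Set.toFinite _)).2 ⟨_, hr, c, hc, d, hd, hne.1, hne.2, hcd⟩)
  rcases hright_eq with e | e
  · exact Or.inl ⟨e ▸ hci, fun hj => hbranch _ hr (e ▸ hci) hj⟩
  · exact Or.inr ⟨e ▸ hdj, fun hi => hbranch _ hr hi (e ▸ hdj)⟩

namespace IsPlanarTree

variable {ℓ : ι → V} {right : V → V} (h : IsPlanarTree ℓ right)
include h

theorem inf_lt_left {i j : ι} (hij : i ≠ j) : ℓ i ⊓ ℓ j < ℓ i :=
  _root_.inf_lt_left.2 fun hle => hij (h.eq_of_le hle)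

theorem eq_diag_of_inf_eq {s : Sym2 ι} {i : ι} (hs : (s.map ℓ).inf = ℓ i) : s = s(i, i) := by
  induction s with | _ a b => ?_
  rw [Sym2.map_mk, Sym2.inf_mk] at hs
  rw [← h.eq_of_le (hs ▸ inf_le_left : ℓ i ≤ ℓ a), ← h.eq_of_le (hs ▸ inf_le_right : ℓ i ≤ ℓ b)]

theorem right_le_of_lt {v x : V} {i j : ι} (hvx : v < x) (hi : x ≤ ℓ i) (hj : x ≤ ℓ j)
    (hright : right v ≤ ℓ i) : right v ≤ ℓ j := by
  rcases h.isTreeOrder hright hi with hle | hle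
  · exact hle.trans hj
  · rcases (h.wcovBy_right v).eq_or_eq hvx.le hle with rfl | rfl
    exacts [absurd hvx (lt_irrefl _), hj]

theorem lt_inf_of_right_le_iff {v : V} {i j : ι} (hi : v < ℓ i) (hj : v ≤ ℓ j)
    (hside : right v ≤ ℓ i ↔ right v ≤ ℓ j) : v < ℓ i ⊓ ℓ j := by
  refine (le_inf hi.le hj).lt_of_ne fun e => ?_
  have hij : i ≠ j := by
    rintro rfl
    exact hi.ne (e.trans (inf_idem _))
  have hxor := h.xor_right_le hij
  rw [← e] at hxor
  exact (xor_iff_not_iff _ _).1 hxor hside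

theorem inf_le_of_right_le_of_not_right_le {v : V} {i j : ι} (hi : right v ≤ ℓ i)
    (hj : ¬ right v ≤ ℓ j) : ℓ i ⊓ ℓ j ≤ v := by
  by_contra hle
  have hvi : v ≤ ℓ i := (h.wcovBy_right v).le.trans hi
  have hlt : v < ℓ i ⊓ ℓ j :=
    ((h.isTreeOrder hvi inf_le_left).resolve_right hle).lt_of_not_ge hle
  exact hj (h.right_le_of_lt hlt inf_le_left inf_le_right hi)

theorem exists_aligned_pair {i j : ι} (hij : i ≠ j) {t : Sym2 ι}
    (ht : (t.map ℓ).inf = ℓ i ⊓ ℓ j) :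
    ∃ i' j', t = s(i', j') ∧ ℓ i ⊓ ℓ j < ℓ i ⊓ ℓ i' ∧ ℓ i ⊓ ℓ j < ℓ j ⊓ ℓ j' := by
  induction t with | _ a b => ?_
  rw [Sym2.map_mk, Sym2.inf_mk] at ht
  have hi := h.inf_lt_left hij
  have hj : ℓ i ⊓ ℓ j < ℓ j := inf_comm (ℓ j) (ℓ i) ▸ h.inf_lt_left hij.symm
  have ha : ℓ i ⊓ ℓ j ≤ ℓ a := ht ▸ inf_le_left
  have hb : ℓ i ⊓ ℓ j ≤ ℓ b := ht ▸ inf_le_right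
  have hab : a ≠ b := by
    rintro rfl
    rw [inf_idem] at ht
    exact hij ((h.eq_of_le (ht ▸ inf_le_left)).symm.trans (h.eq_of_le (ht ▸ inf_le_right)))
  have hside_ij := (xor_iff_not_iff _ _).1 (h.xor_right_le hij)
  have hside_ab := (xor_iff_not_iff _ _).1 (h.xor_right_le hab)
  rw [ht] at hside_ab
  by_cases hia : right (ℓ i ⊓ ℓ j) ≤ ℓ i ↔ right (ℓ i ⊓ ℓ j) ≤ ℓ a
  · exact ⟨a, b, rfl, h.lt_inf_of_right_le_iff hi ha hia,
      h.lt_inf_of_right_le_iff hj hb (by tauto)⟩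
  · exact ⟨b, a, Sym2.eq_swap, h.lt_inf_of_right_le_iff hi hb (by tauto),
      h.lt_inf_of_right_le_iff hj ha (by tauto)⟩

end IsPlanarTree

end PlanarTree

section Quadrics

variable {V ι : Type*}

/-- The ideal generated by the quadrics `σ_{ac} σ_{bd} - σ_{ad} σ_{bc}` for which some vertex `l` of
the tree separates `a`, `b` from `c`, `d`. -/
def quadricIdeal [LE V] (R : Type*) [CommRing R] (ℓ : ι → V) : Ideal (MvPolynomial (Sym2 ι) R) :=
  Ideal.span {q | ∃ (l : V) (a b c d : ι), l ≤ ℓ a ∧ l ≤ ℓ b ∧ ¬ l ≤ ℓ c ∧ ¬ l ≤ ℓ d ∧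
    q = X s(a, c) * X s(b, d) - X s(a, d) * X s(b, c)}

theorem exists_swap_mem_quadricIdeal [LE V] (R : Type*) [CommRing R] {ℓ : ι → V}
    {u : Sym2 ι →₀ ℕ} {l : V} {a b c d : ι} (ha : l ≤ ℓ a) (hb : l ≤ ℓ b) (hc : ¬ l ≤ ℓ c)
    (hd : ¬ l ≤ ℓ d) (hac : u s(a, c) ≠ 0) (hbd : u s(b, d) ≠ 0) :
    ∃ u', monomial u 1 - monomial u' 1 ∈ quadricIdeal R ℓ ∧ u' s(a, d) ≠ 0 := by
  classical
  rcases eq_or_ne a b with rfl | hab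
  · exact ⟨u, by simp, hbd⟩
  have hne : s(a, c) ≠ s(b, d) := by
    intro e
    rcases Sym2.eq_iff.1 e with ⟨rfl, -⟩ | ⟨rfl, -⟩
    exacts [hab rfl, hd ha]
  obtain ⟨w, rfl⟩ : ∃ w, u = Finsupp.single s(a, c) 1 + Finsupp.single s(b, d) 1 + w := by
    refine exists_add_of_le fun s => ?_
    rw [Finsupp.add_apply, Finsupp.single_apply, Finsupp.single_apply]
    grind
  refine ⟨Finsupp.single s(a, d) 1 + Finsupp.single s(b, c) 1 + w, ?_, by simp⟩
  have hmul : ∀ s t : Sym2 ι, (monomial (Finsupp.single s 1 + Finsupp.single t 1 + w) 1 :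
      MvPolynomial (Sym2 ι) R) = X s * X t * monomial w 1 := by
    intro s t
    simp [X, monomial_mul]
  rw [hmul, hmul, ← sub_mul]
  exact Ideal.mul_mem_right _ _ (Ideal.subset_span ⟨l, a, b, c, d, ha, hb, hc, hd, rfl⟩)

variable [SemilatticeInf V] [Finite V] {ℓ : ι → V}

theorem quadricIdeal_le_ker (R : Type*) [CommRing R] (htree : IsTreeOrder V) (ℓ : ι → V) :
    quadricIdeal R ℓ ≤ RingHom.ker (monomialMap R (observedExp ℓ)) := by
  classical
  rw [quadricIdeal, Ideal.span_le]
  rintro _ ⟨l, a, b, c, d, ha, hb, hc, hd, rfl⟩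
  have hac := htree.inf_eq_inf ha hb hc
  have had := htree.inf_eq_inf ha hb hd
  have hexp : observedExp ℓ s(a, c) + observedExp ℓ s(b, d) =
      observedExp ℓ s(a, d) + observedExp ℓ s(b, c) := by
    ext (v | v)
    · simp only [observedExp, Sym2.map_mk, Finsupp.add_apply, pathExp_mk_inl, hac, had, add_comm]
    · have hacv : v ≤ ℓ a ∧ v ≤ ℓ c ↔ v ≤ ℓ b ∧ v ≤ ℓ c := by rw [← le_inf_iff, hac, le_inf_iff]
      have hadv : v ≤ ℓ a ∧ v ≤ ℓ d ↔ v ≤ ℓ b ∧ v ≤ ℓ d := by rw [← le_inf_iff, had, le_inf_iff]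
      simp only [observedExp, Sym2.map_mk, Finsupp.add_apply, pathExp_mk_inr, Xor]
      by_cases h₁ : v ≤ ℓ a <;> by_cases h₂ : v ≤ ℓ b <;> by_cases h₃ : v ≤ ℓ c <;>
        by_cases h₄ : v ≤ ℓ d <;> simp_all
  rw [SetLike.mem_coe, RingHom.mem_ker, map_sub, map_mul, map_mul]
  simp only [monomialMap, aeval_X, monomial_mul, hexp, sub_self]

theorem exists_inf_eq_of_weight_eq {u u' : Sym2 ι →₀ ℕ}
    (huu : Finsupp.weight (observedExp ℓ) u = Finsupp.weight (observedExp ℓ) u') {s : Sym2 ι}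
    (hs : u s ≠ 0) : ∃ t, u' t ≠ 0 ∧ (t.map ℓ).inf = (s.map ℓ).inf := by
  obtain ⟨t, hut, ht⟩ := weight_apply_ne_zero_iff.1 (huu ▸ weight_apply_ne_zero_iff.2
    ⟨s, hs, pathExp_inl_ne_zero.2 rfl⟩ :
      Finsupp.weight (observedExp ℓ) u' (Sum.inl (s.map ℓ).inf) ≠ 0)
  exact ⟨t, hut, pathExp_inl_ne_zero.1 ht⟩

namespace IsPlanarTree

variable {right : V → V} (h : IsPlanarTree ℓ right)
include h

theorem observedExp_inr_ne_zero {s : Sym2 ι} {i : ι} :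
    observedExp ℓ s (Sum.inr (ℓ i)) ≠ 0 ↔ ∃ k, k ≠ i ∧ s = s(i, k) := by
  classical
  have hle : ∀ a, ℓ i ≤ ℓ a ↔ i = a := fun a => ⟨h.eq_of_le, fun e => e ▸ le_rfl⟩
  induction s with | _ a b => ?_
  simp only [observedExp, Sym2.map_mk, pathExp_mk_inr, hle, ne_eq, ite_eq_right_iff, one_ne_zero,
    imp_false, not_not]
  constructor
  · rintro (⟨rfl, hb⟩ | ⟨rfl, ha⟩)
    exacts [⟨b, Ne.symm hb, rfl⟩, ⟨a, Ne.symm ha, Sym2.eq_swap⟩]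
  · rintro ⟨k, hk, e⟩
    rcases Sym2.eq_iff.1 e with ⟨rfl, rfl⟩ | ⟨rfl, rfl⟩
    exacts [Or.inl ⟨rfl, Ne.symm hk⟩, Or.inr ⟨rfl, Ne.symm hk⟩]

theorem exists_partner_of_weight_eq {u u' : Sym2 ι →₀ ℕ}
    (huu : Finsupp.weight (observedExp ℓ) u = Finsupp.weight (observedExp ℓ) u') {i j : ι}
    (hij : i ≠ j) (hu : u s(i, j) ≠ 0) : ∃ k, k ≠ i ∧ u' s(i, k) ≠ 0 := by
  obtain ⟨s, hus, hs⟩ := weight_apply_ne_zero_iff.1 (huu ▸ weight_apply_ne_zero_iff.2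
    ⟨s(i, j), hu, h.observedExp_inr_ne_zero.2 ⟨j, hij.symm, rfl⟩⟩ :
      Finsupp.weight (observedExp ℓ) u' (Sum.inr (ℓ i)) ≠ 0)
  obtain ⟨k, hki, rfl⟩ := h.observedExp_inr_ne_zero.1 hs
  exact ⟨k, hki, hus⟩

theorem exists_common_factor (R : Type*) [CommRing R] [Nontrivial R] {u u' : Sym2 ι →₀ ℕ}
    (huu : Finsupp.weight (observedExp ℓ) u = Finsupp.weight (observedExp ℓ) u') (hu' : u' ≠ 0) :
    ∃ u₁ s, monomial u 1 - monomial u₁ 1 ∈ quadricIdeal R ℓ ∧ u₁ s ≠ 0 ∧ u' s ≠ 0 := by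
  -- A pair that branches as low as possible can be moved into `u` by swapping partners.
  obtain ⟨s, hs, hmax⟩ := Finset.exists_maximalFor (fun s : Sym2 ι => (s.map ℓ).inf) u'.support
    (Finsupp.support_nonempty_iff.2 hu')
  rw [Finsupp.mem_support_iff] at hs
  have hlowest : ∀ {v : Sym2 ι →₀ ℕ},
      Finsupp.weight (observedExp ℓ) v = Finsupp.weight (observedExp ℓ) u' →
      ∀ {t}, v t ≠ 0 → ¬ (s.map ℓ).inf < (t.map ℓ).inf := by
    intro v hv t ht hlt
    obtain ⟨t', hut', ht'⟩ := exists_inf_eq_of_weight_eq hv ht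
    rw [← ht'] at hlt
    exact hlt.not_ge (hmax (Finsupp.mem_support_iff.2 hut') hlt.le)
  obtain ⟨t, hut, ht⟩ := exists_inf_eq_of_weight_eq huu.symm hs
  induction s with | _ i j => ?_
  rw [Sym2.map_mk, Sym2.inf_mk] at ht hlowest
  rcases eq_or_ne i j with rfl | hij
  · obtain rfl := h.eq_diag_of_inf_eq (ht.trans (inf_idem _))
    exact ⟨u, s(i, i), by simp, hut, hs⟩
  obtain ⟨i', j', rfl, hi', hj'⟩ := h.exists_aligned_pair hij ht
  rw [Sym2.map_mk, Sym2.inf_mk] at ht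
  obtain ⟨k, -, huk⟩ := h.exists_partner_of_weight_eq huu.symm hij hs
  obtain ⟨u₁, hmem₁, hu₁⟩ := exists_swap_mem_quadricIdeal R (l := ℓ i ⊓ ℓ i') inf_le_left
    inf_le_right (fun hle => hlowest huu huk (hi'.trans_le (le_inf inf_le_left hle)))
    (fun hle => hi'.not_ge (ht ▸ le_inf inf_le_right hle)) huk hut
  have huu₁ := (weight_eq_of_mem_ker_monomialMap
    (quadricIdeal_le_ker R h.isTreeOrder ℓ hmem₁)).symm.trans huu
  obtain ⟨k', -, huk'⟩ := h.exists_partner_of_weight_eq huu₁.symm hij.symm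
    (Sym2.eq_swap (a := i) ▸ hs)
  obtain ⟨u₂, hmem₂, hu₂⟩ := exists_swap_mem_quadricIdeal R (l := ℓ j ⊓ ℓ j') inf_le_left
    inf_le_right (fun hle => hlowest huu₁ huk' (hj'.trans_le (le_inf inf_le_left hle)))
    (fun hle => hj'.not_ge (le_inf hle inf_le_left)) huk' (Sym2.eq_swap (a := i) ▸ hu₁)
  refine ⟨u₂, s(i, j), ?_, Sym2.eq_swap (a := j) ▸ hu₂, hs⟩
  simpa only [sub_add_sub_cancel] using Ideal.add_mem _ hmem₁ hmem₂

theorem monomial_sub_monomial_mem_quadricIdeal (R : Type*) [CommRing R] [Nontrivial R]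
    {u u' : Sym2 ι →₀ ℕ}
    (huu : Finsupp.weight (observedExp ℓ) u = Finsupp.weight (observedExp ℓ) u') :
    monomial u 1 - monomial u' 1 ∈ quadricIdeal R ℓ := by
  induction hN : u'.degree generalizing u u' with
  | zero =>
    rw [Finsupp.degree_eq_zero_iff] at hN
    subst hN
    obtain rfl : u = 0 := by
      ext s
      by_contra hne
      obtain ⟨t, ht, -⟩ := exists_inf_eq_of_weight_eq huu hne
      exact ht rfl
    simp
  | succ N ih =>
    have hu' : u' ≠ 0 := by
      rintro rfl
      simp at hN
    obtain ⟨u₁, s, hmem, hs₁, hs⟩ := h.exists_common_factor R huu hu'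
    have huu₁ := (weight_eq_of_mem_ker_monomialMap
      (quadricIdeal_le_ker R h.isTreeOrder ℓ hmem)).symm.trans huu
    have hfactor : ∀ w : Sym2 ι →₀ ℕ, w s ≠ 0 → ∃ w', w = Finsupp.single s 1 + w' := fun w hw =>
      exists_add_of_le (Finsupp.single_le_iff.2 (Nat.one_le_iff_ne_zero.2 hw))
    obtain ⟨w₁, rfl⟩ := hfactor _ hs₁
    obtain ⟨w, rfl⟩ := hfactor _ hs
    rw [map_add, map_add, add_right_inj] at huu₁
    have hmul : ∀ w : Sym2 ι →₀ ℕ, (monomial (Finsupp.single s 1 + w) 1 :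
        MvPolynomial (Sym2 ι) R) = X s * monomial w 1 := by
      intro w
      simp [X, monomial_mul]
    have hmem' := Ideal.mul_mem_left _ (X s) (ih huu₁ (by simpa [add_comm 1] using hN))
    rw [mul_sub, ← hmul, ← hmul] at hmem'
    simpa only [sub_add_sub_cancel] using Ideal.add_mem _ hmem hmem'

theorem ker_monomialMap_observedExp (R : Type*) [CommRing R] [Nontrivial R] :
    RingHom.ker (monomialMap R (observedExp ℓ)) = quadricIdeal R ℓ :=
  le_antisymm (ker_monomialMap_le fun _ _ => h.monomial_sub_monomial_mem_quadricIdeal R)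
    (quadricIdeal_le_ker R h.isTreeOrder ℓ)

end IsPlanarTree

end Quadrics

section Homogeneous

variable {ι : Type*}

theorem aeval_smul_of_isHomogeneous {R A : Type*} [CommSemiring R] [CommSemiring A] [Algebra R A]
    {f : MvPolynomial ι R} {d : ℕ} (hf : f.IsHomogeneous d) (a : A) (x : ι → A) :
    aeval (a • x) f = a ^ d * aeval x f := by
  rw [aeval_def, aeval_def, eval₂_eq, eval₂_eq, Finset.mul_sum]
  refine Finset.sum_congr rfl fun u hu => ?_
  have hdeg : ∑ i ∈ u.support, u i = d := by
    rw [← hf (mem_support_iff.1 hu)]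
    simp [Finsupp.weight_apply, Finsupp.sum]
  simp only [Pi.smul_apply, smul_eq_mul, mul_pow, Finset.prod_mul_distrib,
    Finset.prod_pow_eq_pow_sum, hdeg]
  ring

theorem homogeneousComponent_mem_vanishingIdeal {k : Type*} [Field k] [Infinite k]
    {S : Set (ι → k)} (hS : ∀ x ∈ S, ∀ c : k, c • x ∈ S) {f : MvPolynomial ι k}
    (hf : f ∈ vanishingIdeal k S) (d : ℕ) : homogeneousComponent d f ∈ vanishingIdeal k S := by
  intro x hx
  -- The restriction of `f` to the line through `x`; its coefficients are the values at `x` of the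
  -- homogeneous components of `f`.
  let g : Polynomial k := ∑ e ∈ Finset.range (f.totalDegree + 1),
    Polynomial.monomial e (aeval x (homogeneousComponent e f))
  have hg : g = 0 := by
    refine Polynomial.funext fun c => ?_
    rw [Polynomial.eval_zero, ← hf _ (hS x hx c)]
    conv_rhs => rw [← sum_homogeneousComponent f, map_sum]
    rw [Polynomial.eval_finsetSum]
    refine Finset.sum_congr rfl fun e _ => ?_
    rw [aeval_smul_of_isHomogeneous (homogeneousComponent_isHomogeneous e f),
      Polynomial.eval_monomial, mul_comm]
  by_cases hd : d ∈ Finset.range (f.totalDegree + 1)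
  · have hcoeff := congrArg (Polynomial.coeff · d) hg
    simpa only [g, Polynomial.finsetSum_coeff, Polynomial.coeff_monomial, Finset.sum_ite_eq', hd,
      if_true, Polynomial.coeff_zero] using hcoeff
  · rw [homogeneousComponent_eq_zero _ _ (by simpa [Nat.lt_succ_iff] using hd), map_zero]

end Homogeneous

section Grassmannian

variable {n : ℕ}

/-- The Plücker coordinates of the `2 × n` matrix with rows `u` and `v`, together with the free
diagonal coordinates `w`. -/
def minor {A : Type*} [CommRing A] (u v w : Fin n → A) (s : Sym2 (Fin n)) : A :=
  if s.IsDiag then w s.inf else u s.inf * v s.sup - u s.sup * v s.inf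

theorem map_minor {A B F : Type*} [CommRing A] [CommRing B] [FunLike F A B] [RingHomClass F A B]
    (f : F) (u v w : Fin n → A) (s : Sym2 (Fin n)) :
    f (minor u v w s) = minor (fun i => f (u i)) (fun i => f (v i)) (fun i => f (w i)) s := by
  unfold minor
  split_ifs
  · rfl
  · rw [map_sub, map_mul, map_mul]

theorem minor_diag {A : Type*} [CommRing A] (u v w : Fin n → A) (i : Fin n) :
    minor u v w s(i, i) = w i := by
  simp [minor]

theorem minor_of_lt {A : Type*} [CommRing A] (u v w : Fin n → A) {i j : Fin n} (h : i < j) :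
    minor u v w s(i, j) = u i * v j - u j * v i := by
  simp [minor, h.ne, h.le]

theorem mem_grassmannianCone_iff {p : Sym2 (Fin n) → ℂ} :
    p ∈ grassmannianCone n ↔ ∃ u v w, p = minor u v w := by
  constructor
  · rintro ⟨A, hA⟩
    have hlt : ∀ i j, i < j → p s(i, j) = minor (A 0) (A 1) (fun i => p s(i, i)) s(i, j) := by
      intro i j hij
      rw [minor_of_lt _ _ _ hij, hA i j hij, Matrix.det_fin_two]
      simp
    refine ⟨A 0, A 1, fun i => p s(i, i), ?_⟩
    ext s
    induction s with | _ i j => ?_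
    rcases lt_trichotomy i j with hij | rfl | hij
    · exact hlt i j hij
    · rw [minor_diag]
    · exact Sym2.eq_swap ▸ hlt j i hij
  · rintro ⟨u, v, w, rfl⟩
    refine ⟨Matrix.of ![u, v], fun i j hij => ?_⟩
    rw [minor_of_lt _ _ _ hij, Matrix.det_fin_two]
    simp

theorem mem_grassmannianIdeal_iff {f : MvPolynomial (Sym2 (Fin n)) ℂ} :
    f ∈ grassmannianIdeal n ↔ ∀ u v w : Fin n → ℂ, aeval (minor u v w) f = 0 := by
  rw [grassmannianIdeal, mem_vanishingIdeal_iff]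
  refine ⟨fun h u v w => h _ (mem_grassmannianCone_iff.2 ⟨u, v, w, rfl⟩), fun h p hp => ?_⟩
  obtain ⟨u, v, w, rfl⟩ := mem_grassmannianCone_iff.1 hp
  exact h u v w

theorem aeval_minor_eq_zero {f : MvPolynomial (Sym2 (Fin n)) ℂ} (hf : f ∈ grassmannianIdeal n)
    {A : Type*} [CommRing A] [Algebra ℂ A] (u v w : Fin n → A) : aeval (minor u v w) f = 0 := by
  -- A polynomial identity over the infinite field `ℂ` holds for generic matrices, hence over `A`.
  let U : Fin n → MvPolynomial (Fin n ⊕ Fin n ⊕ Fin n) ℂ := fun i => X (Sum.inl i)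
  let V : Fin n → MvPolynomial (Fin n ⊕ Fin n ⊕ Fin n) ℂ := fun i => X (Sum.inr (Sum.inl i))
  let W : Fin n → MvPolynomial (Fin n ⊕ Fin n ⊕ Fin n) ℂ := fun i => X (Sum.inr (Sum.inr i))
  have hgeneric : aeval (minor U V W) f = 0 := by
    refine MvPolynomial.funext fun x => ?_
    rw [map_zero, ← coe_aeval_eq_eval, RingHom.coe_coe, ← AlgHom.comp_apply, comp_aeval]
    simp_rw [map_minor]
    exact mem_grassmannianIdeal_iff.1 hf _ _ _
  have hspecialize := congrArg (aeval (Sum.elim u (Sum.elim v w)) : _ →ₐ[ℂ] A) hgeneric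
  rw [map_zero, ← AlgHom.comp_apply, comp_aeval] at hspecialize
  simp_rw [map_minor] at hspecialize
  simpa only [U, V, W, aeval_X, Sum.elim_inl, Sum.elim_inr] using hspecialize

theorem homogeneousComponent_mem_grassmannianIdeal {f : MvPolynomial (Sym2 (Fin n)) ℂ}
    (hf : f ∈ grassmannianIdeal n) (d : ℕ) : homogeneousComponent d f ∈ grassmannianIdeal n := by
  refine homogeneousComponent_mem_vanishingIdeal (fun p hp c => ?_) hf d
  obtain ⟨u, v, w, rfl⟩ := mem_grassmannianCone_iff.1 hp
  refine mem_grassmannianCone_iff.2 ⟨c • u, v, c • w, ?_⟩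
  ext s
  simp only [Pi.smul_apply, smul_eq_mul, minor]
  split_ifs <;> ring

theorem mem_signAct_grassmannianIdeal_iff {τ : Sym2 (Fin n) → ℤˣ}
    {f : MvPolynomial (Sym2 (Fin n)) ℂ} :
    f ∈ signAct τ (grassmannianIdeal n) ↔
      ∀ u v w : Fin n → ℂ, aeval (fun s => ((τ s : ℤ) : ℂ) * minor u v w s) f = 0 := by
  simp only [mem_signAct_iff, mem_grassmannianIdeal_iff, aeval_scaleEquiv]
  rfl

theorem aeval_sign_mul_minor_eq_zero {τ : Sym2 (Fin n) → ℤˣ} {f : MvPolynomial (Sym2 (Fin n)) ℂ}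
    (hf : f ∈ signAct τ (grassmannianIdeal n)) {A : Type*} [CommRing A] [Algebra ℂ A]
    (u v w : Fin n → A) : aeval (fun s => ((τ s : ℤ) : A) * minor u v w s) f = 0 := by
  have h := aeval_minor_eq_zero (mem_signAct_iff.1 hf) u v w
  rw [aeval_scaleEquiv] at h
  simpa using h

end Grassmannian

section SignedMinors

variable {V : Type*} [SemilatticeInf V] {n : ℕ}

open Classical in
/-- The orientation of the pair `i`, `j` in a planar tree: `1` if `ℓ j` lies to the right of the
point where the two branch, `-1` if it lies to the left. -/
def side (ℓ : Fin n → V) (right : V → V) (i j : Fin n) : ℤˣ :=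
  if right (ℓ i ⊓ ℓ j) ≤ ℓ j then 1 else -1

/-- The sign vector that compares the planar order of the family `ℓ` with its labeling. -/
def signVector (ℓ : Fin n → V) (right : V → V) (s : Sym2 (Fin n)) : ℤˣ :=
  if s.IsDiag then 1 else side ℓ right s.inf s.sup

/-- The minors of the `2 × n` matrix with rows `u` and `v`, with the columns of each minor taken in
their planar order rather than in the order of their labels. -/
def planarMinor {A : Type*} [CommRing A] (ℓ : Fin n → V) (right : V → V) (u v w : Fin n → A)
    (s : Sym2 (Fin n)) : A :=
  ((signVector ℓ right s : ℤ) : A) * minor u v w s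

/-- The sign of the third term of a three-term Plücker relation between planar minors. -/
def pluckerSign (ℓ : Fin n → V) (right : V → V) (a b c d : Fin n) : ℤˣ :=
  side ℓ right a c * side ℓ right a d * side ℓ right a b * side ℓ right c d

variable {ℓ : Fin n → V} {right : V → V} {A : Type*} [CommRing A] (u v w : Fin n → A)

theorem planarMinor_diag (i : Fin n) : planarMinor ℓ right u v w s(i, i) = w i := by
  simp [planarMinor, signVector, minor_diag]

namespace IsPlanarTree

variable (h : IsPlanarTree ℓ right)
include h

theorem side_swap {i j : Fin n} (hij : i ≠ j) : side ℓ right j i = -side ℓ right i j := by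
  have hxor := (xor_iff_not_iff _ _).1 (h.xor_right_le hij)
  unfold side
  rw [inf_comm (ℓ j)]
  split_ifs <;> first | rfl | tauto

theorem planarMinor_of_ne {i j : Fin n} (hij : i ≠ j) :
    planarMinor ℓ right u v w s(i, j) =
      ((side ℓ right i j : ℤ) : A) * (u i * v j - u j * v i) := by
  have hlt : ∀ {i j : Fin n}, i < j → planarMinor ℓ right u v w s(i, j) =
      ((side ℓ right i j : ℤ) : A) * (u i * v j - u j * v i) := by
    intro i j hij
    simp [planarMinor, minor_of_lt _ _ _ hij, signVector, hij.ne, hij.le]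
  rcases lt_or_gt_of_ne hij with hij' | hij'
  · exact hlt hij'
  · rw [Sym2.eq_swap, hlt hij', h.side_swap hij]
    push_cast
    ring

theorem planarMinor_plucker {l : V} {a b c d : Fin n} (ha : l ≤ ℓ a) (hb : l ≤ ℓ b)
    (hc : ¬ l ≤ ℓ c) (hd : ¬ l ≤ ℓ d) (hab : a ≠ b) (hcd : c ≠ d) :
    planarMinor ℓ right u v w s(a, c) * planarMinor ℓ right u v w s(b, d) -
        planarMinor ℓ right u v w s(a, d) * planarMinor ℓ right u v w s(b, c) =
      ((pluckerSign ℓ right a b c d : ℤ) : A) *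
        (planarMinor ℓ right u v w s(a, b) * planarMinor ℓ right u v w s(c, d)) := by
  have hac : a ≠ c := fun e => hc (e ▸ ha)
  have had : a ≠ d := fun e => hd (e ▸ ha)
  have hbc : b ≠ c := fun e => hc (e ▸ hb)
  have hbd : b ≠ d := fun e => hd (e ▸ hb)
  have hside_c : side ℓ right b c = side ℓ right a c := by
    unfold side
    rw [h.isTreeOrder.inf_eq_inf ha hb hc]
  have hside_d : side ℓ right b d = side ℓ right a d := by
    unfold side
    rw [h.isTreeOrder.inf_eq_inf ha hb hd]
  have hsq : ∀ x : ℤˣ, ((x : ℤ) : A) * ((x : ℤ) : A) = 1 := by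
    intro x
    rw [← Int.cast_mul, ← Units.val_mul, Int.units_mul_self, Units.val_one, Int.cast_one]
  have hsq_ab := hsq (side ℓ right a b)
  have hsq_cd := hsq (side ℓ right c d)
  simp only [h.planarMinor_of_ne u v w hac, h.planarMinor_of_ne u v w had,
    h.planarMinor_of_ne u v w hbc, h.planarMinor_of_ne u v w hbd,
    h.planarMinor_of_ne u v w hab, h.planarMinor_of_ne u v w hcd, hside_c, hside_d, pluckerSign,
    Units.val_mul, Int.cast_mul]
  generalize ((side ℓ right a b : ℤ) : A) = x at *
  generalize ((side ℓ right c d : ℤ) : A) = y at *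
  linear_combination (-((side ℓ right a c : ℤ) : A) * ((side ℓ right a d : ℤ) : A) *
    (u a * v b - u b * v a) * (u c * v d - u d * v c)) * (y * y * hsq_ab + hsq_cd)

end IsPlanarTree

end SignedMinors

section InitialQuadrics

variable {V : Type*} [SemilatticeInf V]

theorem IsPlanarTree.quadricIdeal_le_initialIdeal {ω : V → ℕ} (hω : StrictAnti ω)
    {n : ℕ} {ℓ : Fin n → V} {right : V → V} (h : IsPlanarTree ℓ right) :
    quadricIdeal ℂ ℓ ≤ initialIdeal (fun s => (ω (s.map ℓ).inf : ℝ))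
      (signAct (signVector ℓ right) (grassmannianIdeal n)) := by
  rw [quadricIdeal, Ideal.span_le]
  rintro _ ⟨l, a, b, c, d, ha, hb, hc, hd, rfl⟩
  rcases eq_or_ne a b with rfl | hab
  · simp [mul_comm]
  rcases eq_or_ne c d with rfl | hcd
  · simp
  have hX : ∀ i j, IsWeightedHomogeneous (fun s => ω (s.map ℓ).inf)
      (X s(i, j) : MvPolynomial (Sym2 (Fin n)) ℂ) (ω (ℓ i ⊓ ℓ j)) :=
    fun i j => isWeightedHomogeneous_X _ _ _
  have hquadric : IsWeightedHomogeneous (fun s => ω (s.map ℓ).inf)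
      (X s(a, c) * X s(b, d) - X s(a, d) * X s(b, c) : MvPolynomial (Sym2 (Fin n)) ℂ)
      (ω (ℓ a ⊓ ℓ c) + ω (ℓ b ⊓ ℓ d)) := by
    refine ((hX a c).mul (hX b d)).sub ?_
    rw [h.isTreeOrder.inf_eq_inf ha hb hc, ← h.isTreeOrder.inf_eq_inf ha hb hd, add_comm]
    exact (hX a d).mul (hX b c)
  have htail := ((hX a b).mul (hX c d)).C_mul (-((pluckerSign ℓ right a b c d : ℤ) : ℂ))
  refine mem_initialIdeal_of_add_mem hquadric htail
    (h.isTreeOrder.inf_add_inf_lt hω ha hb hc hd) ?_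
  rw [mem_signAct_grassmannianIdeal_iff]
  intro u v w
  have hplucker := h.planarMinor_plucker u v w ha hb hc hd hab hcd
  simp only [map_add, map_sub, map_mul, map_neg, aeval_X, map_intCast]
  unfold planarMinor at hplucker
  linear_combination hplucker

end InitialQuadrics

section LimitPoint

theorem sum_monomial_natDegree_le_and_coeff {V K : Type*} [PartialOrder V] [Fintype V]
    [Semiring K] {ω : V → ℕ} (hω : StrictAnti ω) {c : V → K} {m : V}
    (hc : ∀ v, c v ≠ 0 → m ≤ v) :
    (∑ v, Polynomial.monomial (ω v) (c v)).natDegree ≤ ω m ∧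
      (∑ v, Polynomial.monomial (ω v) (c v)).coeff (ω m) = c m := by
  constructor
  · refine Polynomial.natDegree_sum_le_of_forall_le _ _ fun v _ => ?_
    by_cases hv : c v = 0
    · simp [hv]
    · exact (Polynomial.natDegree_monomial_le _).trans (hω.antitone (hc v hv))
  · rw [Polynomial.finsetSum_coeff, Finset.sum_eq_single m]
    · exact Polynomial.coeff_monomial_same _ _
    · intro v _ hvm
      rw [Polynomial.coeff_monomial, ite_eq_right_iff]
      intro hωv
      by_contra hv
      exact (hω ((hc v hv).lt_of_ne hvm.symm)).ne hωv
    · simp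

variable {V : Type*} [SemilatticeInf V]

open Classical in
theorem IsPlanarTree.ite_sub_ite_inf_eq_side {n : ℕ} {ℓ : Fin n → V}
    {right : V → V} (h : IsPlanarTree ℓ right) {K : Type*} [Ring K]
    {i j : Fin n} (hij : i ≠ j) :
    ((if right (ℓ i ⊓ ℓ j) ≤ ℓ j then 1 else 0) - if right (ℓ i ⊓ ℓ j) ≤ ℓ i then 1 else 0 : K) =
      (side ℓ right i j : ℤ) := by
  have hxor := (xor_iff_not_iff _ _).1 (h.xor_right_le hij)
  unfold side
  split_ifs with hj hi hi
  exacts [absurd (iff_of_true hi hj) hxor, by simp, by simp, absurd (iff_of_false hi hj) hxor]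

variable [Fintype V] {K : Type*}

open Classical in
/-- The product of the edge parameters `λ_v` of a point `x` of parameter space along the path from
the root of the tree to `z`. -/
def rootProd [CommMonoid K] (x : V ⊕ V → K) (z : V) : K :=
  ∏ v, if v ≤ z then x (Sum.inr v) else 1

theorem rootProd_ne_zero [Field K] {x : V ⊕ V → K} (hx : ∀ k, x k ≠ 0) (z : V) :
    rootProd x z ≠ 0 := by
  rw [rootProd, Finset.prod_ne_zero_iff]
  intro v _
  split_ifs
  exacts [hx _, one_ne_zero]

theorem sq_rootProd_mul_aeval_monomial_pathExp [CommRing K] [Algebra ℂ K] (x : V ⊕ V → K)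
    (y z : V) :
    rootProd x (y ⊓ z) ^ 2 * aeval x (monomial (pathExp s(y, z)) (1 : ℂ)) =
      x (Sum.inl (y ⊓ z)) * (rootProd x y * rootProd x z) := by
  classical
  simp only [monomial_pathExp, map_mul, map_prod, aeval_X, rootProd, ← Finset.prod_pow,
    apply_ite (aeval x), map_one]
  rw [mul_left_comm, ← Finset.prod_mul_distrib, ← Finset.prod_mul_distrib]
  congr 1
  refine Finset.prod_congr rfl fun v _ => ?_
  simp only [le_inf_iff, Xor]
  by_cases hy : v ≤ y <;> by_cases hz : v ≤ z <;> simp [hy, hz, sq]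

variable [Field K] {n : ℕ}

open Classical in
/-- The lower row of the matrix whose planar minors give `grassmannianCurve`. The division
compensates for the edges above a branching point `v`, which are counted by `rootProd` for both
columns of a minor. -/
def curveRow (ω : V → ℕ) (ℓ : Fin n → V) (right : V → V) (x : V ⊕ V → K) (i : Fin n) :
    Polynomial K :=
  Polynomial.C (rootProd x (ℓ i)) * ∑ v, Polynomial.monomial (ω v)
    ((if right v ≤ ℓ i then 1 else 0) * (x (Sum.inl v) / rootProd x v ^ 2))

/-- A curve on the sign-twisted Grassmannian whose coordinates have as leading coefficients the
values at the point `x` of the monomials given by the trek rule. -/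
def grassmannianCurve (ω : V → ℕ) (ℓ : Fin n → V) (right : V → V) (x : V ⊕ V → K) :
    Sym2 (Fin n) → Polynomial K :=
  planarMinor ℓ right (fun i => Polynomial.C (rootProd x (ℓ i))) (curveRow ω ℓ right x)
    fun i => Polynomial.monomial (ω (ℓ i)) (x (Sum.inl (ℓ i)))

namespace IsPlanarTree

variable {ω : V → ℕ} {ℓ : Fin n → V} {right : V → V} (h : IsPlanarTree ℓ right)
include h

open Classical in
theorem grassmannianCurve_of_ne (x : V ⊕ V → K) {i j : Fin n} (hij : i ≠ j) :
    grassmannianCurve ω ℓ right x s(i, j) =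
      Polynomial.C ((side ℓ right i j : ℤ) * (rootProd x (ℓ i) * rootProd x (ℓ j))) *
        ∑ v, Polynomial.monomial (ω v) (((if right v ≤ ℓ j then 1 else 0) -
          if right v ≤ ℓ i then 1 else 0) * (x (Sum.inl v) / rootProd x v ^ 2)) := by
  rw [grassmannianCurve, h.planarMinor_of_ne _ _ _ hij]
  simp only [curveRow, sub_mul, map_sub, Finset.sum_sub_distrib, Polynomial.C_mul,
    Polynomial.C_eq_intCast]
  ring

theorem grassmannianCurve_natDegree_le_and_coeff [Algebra ℂ K] (hω : StrictAnti ω)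
    {x : V ⊕ V → K} (hx : ∀ k, x k ≠ 0) (s : Sym2 (Fin n)) :
    (grassmannianCurve ω ℓ right x s).natDegree ≤ ω (s.map ℓ).inf ∧
      (grassmannianCurve ω ℓ right x s).coeff (ω (s.map ℓ).inf) =
        aeval x (monomial (observedExp ℓ s) (1 : ℂ)) := by
  classical
  induction s with | _ i j => ?_
  have hmonomial := sq_rootProd_mul_aeval_monomial_pathExp x (ℓ i) (ℓ j)
  have hroot := rootProd_ne_zero hx
  rw [observedExp, Sym2.map_mk, Sym2.inf_mk]
  rcases eq_or_ne i j with rfl | hij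
  · rw [inf_idem] at hmonomial ⊢
    rw [grassmannianCurve, planarMinor_diag]
    refine ⟨Polynomial.natDegree_monomial_le _, ?_⟩
    rw [Polynomial.coeff_monomial_same, ← mul_right_inj' (pow_ne_zero 2 (hroot (ℓ i))), hmonomial]
    ring
  rw [h.grassmannianCurve_of_ne x hij]
  have hlead := sum_monomial_natDegree_le_and_coeff hω (m := ℓ i ⊓ ℓ j)
    (c := fun v => ((if right v ≤ ℓ j then 1 else 0) - if right v ≤ ℓ i then 1 else 0) *
      (x (Sum.inl v) / rootProd x v ^ 2)) fun v hv => by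
    by_cases hi : right v ≤ ℓ i <;> by_cases hj : right v ≤ ℓ j
    · simp [hi, hj] at hv
    · exact h.inf_le_of_right_le_of_not_right_le hi hj
    · exact inf_comm (ℓ i) (ℓ j) ▸ h.inf_le_of_right_le_of_not_right_le hj hi
    · simp [hi, hj] at hv
  refine ⟨(Polynomial.natDegree_C_mul_le _ _).trans hlead.1, ?_⟩
  have hside : ((side ℓ right i j : ℤ) : K) * (side ℓ right i j : ℤ) = 1 := by
    rw [← Int.cast_mul, ← Units.val_mul, Int.units_mul_self, Units.val_one, Int.cast_one]
  rw [Polynomial.coeff_C_mul, hlead.2, h.ite_sub_ite_inf_eq_side hij,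
    ← mul_right_inj' (pow_ne_zero 2 (hroot (ℓ i ⊓ ℓ j))), hmonomial]
  have := hroot (ℓ i ⊓ ℓ j)
  field_simp
  linear_combination (x (Sum.inl (ℓ i ⊓ ℓ j)) * rootProd x (ℓ i) * rootProd x (ℓ j)) * hside

end IsPlanarTree

end LimitPoint

namespace IsPlanarTree

variable {V : Type*} [SemilatticeInf V] [Finite V] {n : ℕ} {ω : V → ℕ} {ℓ : Fin n → V}
  {right : V → V} (h : IsPlanarTree ℓ right)
include h

theorem initialIdeal_le_ker (hω : StrictAnti ω) :
    initialIdeal (fun s => (ω (s.map ℓ).inf : ℝ))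
        (signAct (signVector ℓ right) (grassmannianIdeal n)) ≤
      RingHom.ker (monomialMap ℂ (observedExp ℓ)) := by
  have := Fintype.ofFinite V
  rw [initialIdeal, Ideal.span_le]
  rintro _ ⟨f, hf, rfl⟩
  let K := FractionRing (MvPolynomial (V ⊕ V) ℂ)
  let x : V ⊕ V → K := fun k => algebraMap (MvPolynomial (V ⊕ V) ℂ) K (X k)
  have hinj : Function.Injective (algebraMap (MvPolynomial (V ⊕ V) ℂ) K) :=
    IsFractionRing.injective _ _
  have hx : ∀ k, x k ≠ 0 := fun k => (map_ne_zero_iff _ hinj).2 (X_ne_zero k)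
  have hcurve := h.grassmannianCurve_natDegree_le_and_coeff (ω := ω) hω hx
  have hlead := coeff_aeval_eq_aeval_coeff (fun s => (hcurve s).1) (f := f) le_rfl
  have hvanish : aeval (grassmannianCurve ω ℓ right x) f = 0 :=
    aeval_sign_mul_minor_eq_zero hf _ _ _
  have haeval : aeval x = IsScalarTower.toAlgHom ℂ (MvPolynomial (V ⊕ V) ℂ) K :=
    MvPolynomial.algHom_ext fun k => aeval_X _ _
  simp only [hvanish, Polynomial.coeff_zero, (hcurve _).2, haeval, ← comp_aeval_apply] at hlead
  rw [SetLike.mem_coe, RingHom.mem_ker, initialForm_natCast]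
  exact hinj (hlead.symm.trans (map_zero _).symm)

theorem ker_monomialMap_eq_initialIdeal (hω : StrictAnti ω) :
    RingHom.ker (monomialMap ℂ (observedExp ℓ)) =
      initialIdeal (fun s => (ω (s.map ℓ).inf : ℝ))
        (signAct (signVector ℓ right) (grassmannianIdeal n)) :=
  le_antisymm ((h.ker_monomialMap_observedExp ℂ).trans_le (h.quadricIdeal_le_initialIdeal hω))
    (h.initialIdeal_le_ker hω)

end IsPlanarTree

end HiddenTree

end

theorem mainTheorem6_general {V : Type*} [Finite V] (T : Digraph V)
    (hT : HiddenTree.IsRootedBinaryTree T) (n : ℕ) (obs : Fin n → V)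
    (hobs : ∀ i j, Relation.ReflTransGen T.Adj (obs i) (obs j) → i = j) :
    (∃ (ω : Sym2 (Fin n) → ℝ) (τ : Sym2 (Fin n) → ℤˣ),
      HiddenTree.observedIdeal T obs =
        HiddenTree.signAct τ (HiddenTree.initialIdeal ω (HiddenTree.grassmannianIdeal n))) ∧
    HiddenTree.IsToricDegeneration (HiddenTree.grassmannianIdeal n)
      (HiddenTree.observedIdeal T obs) := by
  let _ := hT.semilatticeInf
  obtain ⟨right, h⟩ := hT.isTreeOrder.exists_isPlanarTree
    (fun v => by simpa only [← hT.adj_iff_covBy] using hT.ncard_children_le v) hobs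
  have hω : StrictAnti fun v : V => (Set.Ici v).ncard := fun v w hvw =>
    Set.ncard_lt_ncard (Set.Ici_ssubset_Ici.2 hvw)
  have hker := HiddenTree.observedIdeal_eq_ker_monomialMap hT.isTreeOrder hT.adj_iff_covBy obs
  have hinitial := hker.trans (h.ker_monomialMap_eq_initialIdeal hω)
  refine ⟨⟨_, _, hinitial.trans (HiddenTree.signAct_initialIdeal _ _).symm⟩, ?_⟩
  have htoric := HiddenTree.isToricIdeal_ker_monomialMap (HiddenTree.observedExp obs)
  rw [← hker, hinitial] at htoric
  rw [hinitial]
  exact HiddenTree.isToricDegeneration_initialIdeal_signAct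
    (fun _ hf d => HiddenTree.homogeneousComponent_mem_grassmannianIdeal hf d) _ _ htoric

theorem mainTheorem6 {V : Type*} [Finite V] (T : Digraph V)
    (hT : HiddenTree.IsRootedBinaryTree T)
    (n : ℕ) (leaf : Fin n ≃ {v : V // HiddenTree.IsLeaf T v}) :
    (∃ (ω : Sym2 (Fin n) → ℝ) (τ : Sym2 (Fin n) → ℤˣ),
      HiddenTree.observedIdeal T (fun i => (leaf i : V)) =
        HiddenTree.signAct τ
          (HiddenTree.initialIdeal ω (HiddenTree.grassmannianIdeal n))) ∧
    HiddenTree.IsToricDegeneration (HiddenTree.grassmannianIdeal n)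
      (HiddenTree.observedIdeal T (fun i => (leaf i : V))) :=
  mainTheorem6_general T hT n _ fun i _ hij => leaf.injective <| Subtype.ext <|
    hij.cases_head.elim id fun ⟨_, hadj, _⟩ => absurd hadj ((leaf i).2 _)
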